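/- **Setting.** Let $e_1=(1,0)$, $e_2=(0,1)$ and $S=2\mathbb Z^2\cup(e_1+2\mathbb Z^2)\cup(e_2+2\mathbb Z^2)\subset\mathbb Z^2$. Let $\mathcal J=\bigoplus_{\rho\in S}\mathbb C\,x^\rho$ be the complex Jordan algebra with $x^\rho\cdot x^\tau=x^{\rho+\tau}$ if $\rho+\tau\in S$ and $x^\rho\cdot x^\tau=0$ otherwise; write $L_a$ for the multiplication by $a\in\mathcal J$. Let $\langle\mathcal J,\mathcal J\rangle$ be the quotient of $\mathcal J\otimes\mathcal J$ by the span of all $a\otimes b+b\otimes a$ and $ab\otimes c+bc\otimes a+ca\otimes b$, and let $\langle a,b\rangle$ be the class of $a\otimes b$. The baby TKK algebra is the complex Lie algebra $\widehat{\mathcal G}(\mathcal J)=(\mathfrak{sl}_2\otimes\mathcal J)\oplus\langle\mathcal J,\mathcal J\rangle$ with $$[A\otimes a,B\otimes b]=[A,B]\otimes ab+2\,\mathrm{tr}(AB)\langle a,b\rangle,\quad [\langle a,b\rangle,A\otimes c]=A\otimes[L_a,L_b]c,$$ $$[\langle a,b\rangle,\langle c,d\rangle]=\langle[L_a,L_b]c,d\rangle+\langle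 c,[L_a,L_b]d\rangle .$$ Let $x_+,x_-,\alpha^\vee$ be the standard Chevalley basis of $\mathfrak{sl}_2$. For $\rho=(m,n)\in\mathbb Z^2$ put $x_\pm(m,n)=x_\pm\otimes x^\rho$ if $\rho\in S$ and $x_\pm(m,n)=0$ otherwise; $\alpha^\vee(m,n)=\alpha^\vee\otimes x^\rho$ if $\rho\in S$ and $\alpha^\vee(m,n)=2\langle x^{e_1},x^{\rho-e_1}\rangle$ otherwise; and, for $i=1,2$, $C_i(m,n)=\langle x^{e_i},x^{\rho-e_i}\rangle$ if $\rho\in2\mathbb Z^2$ and $C_i(m,n)=0$ otherwise. Put $C_1=C_1(0,0)$. A $\widehat{\mathcal G}(\mathcal J)$-module $W$ is *of level* $\ell\in\mathbb C$ if $2C_1$ acts on $W$ as the scalar $\ell$. It is *restricted* if for all $w\in W$, $n\in\mathbb Z$ and $s\in\mathbb Z\setminus\{0\}$ one has $x_\pm(m,n)w=0$, $\alpha^\vee(m,n)w=0$, $C_1(2m,2s)w=0$ and $C_2(2m,0)w=0$ whenever $m$ is sufficiently large. It is *integrable* if $x_+(m,n)$ and $x_-(m,n)$ act locally nilpotently on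 $W$ for all $(m,n)\in S$. For $n\in\mathbb Z$ set $x_\pm(z,n)=\sum_{m\in\mathbb Z}x_\pm(m,n)z^{-m-1}$. On a restricted module the powers $x_\pm(z,n)^k$, $k\ge1$, are well defined: applied to any vector, the sum giving the coefficient of each power of $z$ has only finitely many nonzero terms. **Proposition.** Let $\ell$ be a complex number and let $W$ be a nonzero restricted $\widehat{\mathcal G}(\mathcal J)$-module of level $\ell$. Then $W$ is integrable if and only if $\ell$ is a nonnegative integer and, for all $n\in\mathbb Z$, $$x_\pm(z,2n)^{\ell+1}=0\quad\text{and}\quad x_\pm(z,2n+1)^{2\ell+1}=0\qquad\text{on }W .$$ -/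

import Mathlib

open scoped TensorProduct

noncomputable section

set_option linter.unusedSectionVars false

namespace BabyTKK

section General

variable (A : Type*) [NonUnitalNonAssocCommRing A] [Module ℂ A]

/-- The space spanned by `a ⊗ b + b ⊗ a` and `ab ⊗ c + bc ⊗ a + ca ⊗ b`. -/
def relations : Submodule ℂ (A ⊗[ℂ] A) :=
  Submodule.span ℂ ({t | ∃ a b : A, t = a ⊗ₜ[ℂ] b + b ⊗ₜ[ℂ] a} ∪
    {t | ∃ a b c : A,
      t = (a * b) ⊗ₜ[ℂ] c + (b * c) ⊗ₜ[ℂ] a + (c * a) ⊗ₜ[ℂ] b})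

/-- The quotient space `⟨A, A⟩` of `A ⊗ A`. -/
abbrev InnerSpace : Type _ := (A ⊗[ℂ] A) ⧸ relations A

variable {A}

/-- The class `⟨a, b⟩` of `a ⊗ b`. -/
def angle (a b : A) : InnerSpace A := (relations A).mkQ (a ⊗ₜ[ℂ] b)

lemma angle_add_left (a b c : A) : angle (a + b) c = angle a c + angle b c := by
  simp [angle, TensorProduct.add_tmul]

lemma angle_add_right (a b c : A) : angle a (b + c) = angle a b + angle a c := by
  simp [angle, TensorProduct.tmul_add]

lemma angle_sub_left (a b c : A) : angle (a - b) c = angle a c - angle b c := by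
  simp [angle, TensorProduct.sub_tmul]

lemma angle_sub_right (a b c : A) : angle a (b - c) = angle a b - angle a c := by
  simp [angle, TensorProduct.tmul_sub]

lemma angle_smul_left (r : ℂ) (a b : A) : angle (r • a) b = r • angle a b := by
  simp only [angle, ← TensorProduct.smul_tmul', map_smul]

lemma angle_skew (a b : A) : angle a b = - angle b a := by
  rw [eq_neg_iff_add_eq_zero, angle, angle, ← map_add, Submodule.mkQ_apply,
    Submodule.Quotient.mk_eq_zero]
  exact Submodule.subset_span (Or.inl ⟨a, b, rfl⟩)

lemma angle_cyclic (a b c : A) :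
    angle (a * b) c + angle (b * c) a + angle (c * a) b = 0 := by
  rw [angle, angle, angle, ← map_add, ← map_add, Submodule.mkQ_apply,
    Submodule.Quotient.mk_eq_zero]
  exact Submodule.subset_span (Or.inr ⟨a, b, c, rfl⟩)

lemma innerSpace_induction {P : InnerSpace A → Prop} (p : InnerSpace A)
    (h0 : P 0) (h : ∀ a b, P (angle a b)) (hadd : ∀ p q, P p → P q → P (p + q)) : P p := by
  obtain ⟨t, rfl⟩ := (relations A).mkQ_surjective p
  induction t using TensorProduct.induction_on with
  | zero => simpa using h0
  | tmul a b => exact h a b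
  | add s t hs ht => rw [map_add]; exact hadd _ _ hs ht

variable [IsScalarTower ℂ A A] [SMulCommClass ℂ A A]

/-- `[L_a, L_b]`, where `L_a` is the multiplication by `a`. -/
def innerDer : A →ₗ[ℂ] A →ₗ[ℂ] (A →ₗ[ℂ] A) :=
  LinearMap.mk₂ ℂ
    (fun a b => LinearMap.mulLeft ℂ a ∘ₗ LinearMap.mulLeft ℂ b
      - LinearMap.mulLeft ℂ b ∘ₗ LinearMap.mulLeft ℂ a)
    (fun a a' b => by ext x; simp [add_mul, mul_add]; abel)
    (fun r a b => by ext x; simp [smul_mul_assoc, smul_sub])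
    (fun a b b' => by ext x; simp [add_mul, mul_add]; abel)
    (fun r a b => by ext x; simp [smul_mul_assoc, smul_sub])

lemma innerDer_apply (a b x : A) : innerDer a b x = a * (b * x) - b * (a * x) := rfl

/-- The endomorphism `D ⊗ 1 + 1 ⊗ D` of `A ⊗ A` for an endomorphism `D` of `A`. -/
def diag (D : A →ₗ[ℂ] A) : A ⊗[ℂ] A →ₗ[ℂ] A ⊗[ℂ] A :=
  LinearMap.rTensor A D + LinearMap.lTensor A D

variable [IsCommJordan A]

/-- The linearised Jordan identity. -/
lemma jordan_linearized (a b c d : A) :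
    a * ((b * c) * d) + b * ((c * a) * d) + c * ((a * b) * d)
      = (b * c) * (a * d) + (c * a) * (b * d) + (a * b) * (c * d) := by
  let _ : LieRing (AddMonoid.End A) := LieRing.ofAssociativeRing
  have h := two_nsmul_lie_lmul_lmul_add_add_eq_zero a b c
  have h' := DFunLike.congr_fun h d
  have h2 : (2 : ℂ) • ((a * ((b * c) * d) + b * ((c * a) * d) + c * ((a * b) * d))
      - ((b * c) * (a * d) + (c * a) * (b * d) + (a * b) * (c * d))) = 0 := by
    refine Eq.trans ?_ h'
    rw [two_smul, ← two_nsmul]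
    change _ = 2 • ((a * ((b * c) * d) - (b * c) * (a * d)) + (b * ((c * a) * d)
      - (c * a) * (b * d)) + (c * ((a * b) * d) - (a * b) * (c * d)))
    congr 1
    abel
  rw [smul_eq_zero] at h2
  exact sub_eq_zero.mp (h2.resolve_left two_ne_zero)

lemma innerDer_mul (a b c d : A) :
    innerDer a b (c * d) = innerDer a b c * d + c * innerDer a b d := by
  have h1 := jordan_linearized a c d b
  have h2 := jordan_linearized b c d a
  simp only [innerDer_apply, sub_mul, mul_sub]
  simp only [mul_comm] at h1 h2 ⊢
  linear_combination (norm := module) (1 : ℂ) • h1 - (1 : ℂ) • h2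

/-- The linear map `⟨A, A⟩ → End A` sending `⟨a, b⟩` to `[L_a, L_b]`. -/
def der : InnerSpace A →ₗ[ℂ] (A →ₗ[ℂ] A) :=
  (relations A).liftQ (TensorProduct.lift innerDer) <| by
    refine Submodule.span_le.mpr ?_
    rintro t (⟨a, b, rfl⟩ | ⟨a, b, c, rfl⟩)
    · ext x
      simp [innerDer_apply]
    · ext x
      have h := jordan_linearized a b c x
      simp only [map_add, TensorProduct.lift.tmul,
        LinearMap.add_apply, innerDer_apply, LinearMap.zero_apply]
      rw [← sub_eq_zero] at h
      rw [← neg_eq_zero, ← h]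
      abel

lemma der_angle (a b x : A) : der (angle a b) x = a * (b * x) - b * (a * x) := by
  rfl

lemma der_mul (p : InnerSpace A) (c d : A) : der p (c * d) = der p c * d + c * der p d := by
  induction p using innerSpace_induction with
  | h0 => simp
  | h a b => simpa only [innerDer_apply, der_angle] using innerDer_mul a b c d
  | hadd p q hp hq =>
    simp only [map_add, LinearMap.add_apply, hp, hq, add_mul, mul_add]
    abel

lemma relations_le_comap (p : InnerSpace A) :
    relations A ≤ (relations A).comap (diag (der p)) := by
  refine Submodule.span_le.mpr ?_
  rintro t (⟨a, b, rfl⟩ | ⟨a, b, c, rfl⟩)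
  · have h1 : der p a ⊗ₜ[ℂ] b + b ⊗ₜ[ℂ] der p a ∈ relations A :=
      Submodule.subset_span (Or.inl ⟨_, _, rfl⟩)
    have h2 : a ⊗ₜ[ℂ] der p b + der p b ⊗ₜ[ℂ] a ∈ relations A :=
      Submodule.subset_span (Or.inl ⟨_, _, rfl⟩)
    have h := add_mem h1 h2
    simp only [SetLike.mem_coe, Submodule.mem_comap, diag, LinearMap.add_apply, map_add,
      LinearMap.rTensor_tmul, LinearMap.lTensor_tmul]
    convert h using 1
    abel
  · have h1 (a b c : A) : (a * b) ⊗ₜ[ℂ] c + (b * c) ⊗ₜ[ℂ] a + (c * a) ⊗ₜ[ℂ] b ∈ relations A :=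
      Submodule.subset_span (Or.inr ⟨a, b, c, rfl⟩)
    have h := add_mem (add_mem (h1 (der p a) b c) (h1 a (der p b) c)) (h1 a b (der p c))
    simp only [SetLike.mem_coe, Submodule.mem_comap, diag, LinearMap.add_apply, map_add,
      LinearMap.rTensor_tmul, LinearMap.lTensor_tmul, der_mul, TensorProduct.add_tmul]
    convert h using 1
    abel

/-- The bracket `[⟨a, b⟩, ⟨c, d⟩] = ⟨[L_a, L_b] c, d⟩ + ⟨c, [L_a, L_b] d⟩` of `⟨A, A⟩`. -/
def innerBracket : InnerSpace A →ₗ[ℂ] InnerSpace A →ₗ[ℂ] InnerSpace A where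
  toFun p := (relations A).mapQ (relations A) (diag (der p)) (relations_le_comap p)
  map_add' p q := by
    ext c d
    simp [diag]
    abel
  map_smul' r p := by
    ext c d
    simp [diag]

lemma innerBracket_angle (p : InnerSpace A) (c d : A) :
    innerBracket p (angle c d) = angle (der p c) d + angle c (der p d) := by
  simp [innerBracket, angle, diag]

lemma innerBracket_skew (p q : InnerSpace A) : innerBracket p q = - innerBracket q p := by
  induction p using innerSpace_induction with
  | h0 => simp
  | hadd p p' hp hp' => simp [hp, hp']; abel
  | h a b =>
    induction q using innerSpace_induction with
    | h0 => simp
    | hadd q q' hq hq' => simp [hq, hq']; abel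
    | h c d =>
      simp only [innerBracket_angle, der_angle, angle_sub_left, angle_sub_right]
      have e1 := angle_cyclic a (b * c) d
      have e2 := angle_cyclic b (a * c) d
      have e3 := angle_cyclic a (b * d) c
      have e4 := angle_cyclic b (a * d) c
      have s1 := angle_skew a (d * (c * b))
      have s2 := angle_skew c (a * (b * d))
      have s3 := angle_skew a (c * (d * b))
      have s4 := angle_skew c (b * (a * d))
      have s5 := angle_skew (b * c) (a * d)
      have s6 := angle_skew (a * c) (b * d)
      simp only [mul_comm] at e1 e2 e3 e4 s1 s2 s3 s4 s5 s6 ⊢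
      linear_combination (norm := module) (1 : ℂ) • (e1 - e2 - e3 + e4 - s1 + s2 + s3 - s4 - s5 + s6)

lemma der_innerBracket (p q : InnerSpace A) (x : A) :
    der (innerBracket p q) x = der p (der q x) - der q (der p x) := by
  induction q using innerSpace_induction with
  | h0 => simp
  | hadd q q' hq hq' => simp [hq, hq']; abel
  | h c d =>
    simp only [innerBracket_angle, map_add, LinearMap.add_apply, der_angle, map_sub, der_mul,
      mul_add]
    abel

lemma innerBracket_jacobi (p q r : InnerSpace A) :
    innerBracket p (innerBracket q r)
      = innerBracket (innerBracket p q) r + innerBracket q (innerBracket p r) := by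
  induction r using innerSpace_induction with
  | h0 => simp
  | hadd r r' h h' => simp only [map_add, h, h']; abel
  | h c d =>
    simp only [innerBracket_angle, map_add, der_innerBracket, angle_sub_left, angle_sub_right]
    abel

/-- The Lie algebra of traceless complex `2 × 2` matrices. -/
abbrev sl2 : Type := LieAlgebra.SpecialLinear.sl (Fin 2) ℂ

/-- The trace form `(X, Y) ↦ tr (X Y)`. -/
def trForm : sl2 →ₗ[ℂ] sl2 →ₗ[ℂ] ℂ :=
  LinearMap.mk₂ ℂ (fun X Y => (X.val * Y.val).trace)
    (fun X X' Y => by simp [add_mul]) (fun r X Y => by simp)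
    (fun X Y Y' => by simp [mul_add]) (fun r X Y => by simp)

lemma trForm_apply (X Y : sl2) : trForm X Y = (X.val * Y.val).trace := rfl

lemma trForm_comm (X Y : sl2) : trForm X Y = trForm Y X := by
  rw [trForm_apply, trForm_apply, Matrix.trace_mul_comm]

/-- The bracket of `sl2` as a bilinear map. -/
def slBracket : sl2 →ₗ[ℂ] sl2 →ₗ[ℂ] sl2 :=
  LinearMap.mk₂ ℂ (fun X Y => ⁅X, Y⁆)
    add_lie (fun r X Y => smul_lie r X Y) lie_add (fun r X Y => lie_smul r X Y)

lemma slBracket_apply (X Y : sl2) : slBracket X Y = ⁅X, Y⁆ := rfl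

lemma trForm_lie (X Y Z : sl2) : trForm ⁅X, Y⁆ Z = trForm X ⁅Y, Z⁆ := by
  simp only [trForm_apply, LieAlgebra.SpecialLinear.sl_bracket, sub_mul, mul_sub,
    Matrix.trace_sub]
  congr 1
  · rw [mul_assoc]
  · rw [Matrix.trace_mul_comm, ← mul_assoc, Matrix.trace_mul_comm]

lemma sl2_traceless (X : sl2) : X.val 1 1 = - X.val 0 0 := by
  have h : X.val.trace = 0 := X.property
  rw [Matrix.trace_fin_two] at h
  linear_combination h

lemma sl2_lie_lie (X Y Z : sl2) :
    ⁅⁅X, Y⁆, Z⁆ = (2 * trForm Y Z) • X - (2 * trForm X Z) • Y := by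
  have hX := sl2_traceless X
  have hY := sl2_traceless Y
  have hZ := sl2_traceless Z
  apply Subtype.ext
  rw [LieAlgebra.SpecialLinear.sl_bracket, LieAlgebra.SpecialLinear.sl_bracket]
  ext i j
  fin_cases i <;> fin_cases j <;>
    simp [trForm_apply, Matrix.mul_apply, Matrix.trace_fin_two, Fin.sum_univ_two, hX, hY, hZ] <;>
    ring

/-- The bilinear map `(X ⊗ a, Y ⊗ b) ↦ [X, Y] ⊗ ab`. -/
def tensorBracket : (sl2 ⊗[ℂ] A) →ₗ[ℂ] (sl2 ⊗[ℂ] A) →ₗ[ℂ] (sl2 ⊗[ℂ] A) :=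
  TensorProduct.map₂ slBracket (LinearMap.mul ℂ A)

/-- The bilinear map `(a, b) ↦ ⟨a, b⟩`. -/
def angleBilin : A →ₗ[ℂ] A →ₗ[ℂ] InnerSpace A :=
  (TensorProduct.mk ℂ A A).compr₂ (relations A).mkQ

/-- The bilinear map `(X ⊗ a, Y ⊗ b) ↦ 2 tr(X Y) ⟨a, b⟩`. -/
def tensorPairing : (sl2 ⊗[ℂ] A) →ₗ[ℂ] (sl2 ⊗[ℂ] A) →ₗ[ℂ] InnerSpace A :=
  (2 : ℂ) • (TensorProduct.map₂ trForm (angleBilin (A := A))).compr₂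
    (TensorProduct.lid ℂ (InnerSpace A)).toLinearMap

/-- The bilinear map `(⟨a, b⟩, X ⊗ c) ↦ X ⊗ [L_a, L_b] c`. -/
def innerAction : InnerSpace A →ₗ[ℂ] (sl2 ⊗[ℂ] A) →ₗ[ℂ] (sl2 ⊗[ℂ] A) :=
  LinearMap.lTensorHom sl2 ∘ₗ der

lemma tensorBracket_tmul (X Y : sl2) (a b : A) :
    tensorBracket (X ⊗ₜ[ℂ] a) (Y ⊗ₜ[ℂ] b) = ⁅X, Y⁆ ⊗ₜ[ℂ] (a * b) := rfl

lemma tensorPairing_tmul (X Y : sl2) (a b : A) :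
    tensorPairing (X ⊗ₜ[ℂ] a) (Y ⊗ₜ[ℂ] b) = (2 * trForm X Y) • angle a b := by
  simp [tensorPairing, angleBilin, angle, mul_smul]

lemma innerAction_tmul (p : InnerSpace A) (X : sl2) (c : A) :
    innerAction p (X ⊗ₜ[ℂ] c) = X ⊗ₜ[ℂ] der p c := rfl

lemma tensorBracket_skew (u v : sl2 ⊗[ℂ] A) : tensorBracket u v = - tensorBracket v u := by
  induction u using TensorProduct.induction_on with
  | zero => simp
  | add u u' h h' => simp only [map_add, LinearMap.add_apply, h, h']; abel
  | tmul X a =>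
    induction v using TensorProduct.induction_on with
    | zero => simp
    | add v v' h h' => simp only [map_add, LinearMap.add_apply, h, h']; abel
    | tmul Y b =>
      rw [tensorBracket_tmul, tensorBracket_tmul, ← lie_skew, mul_comm, TensorProduct.neg_tmul]

lemma tensorPairing_skew (u v : sl2 ⊗[ℂ] A) : tensorPairing u v = - tensorPairing v u := by
  induction u using TensorProduct.induction_on with
  | zero => simp
  | add u u' h h' => simp only [map_add, LinearMap.add_apply, h, h']; abel
  | tmul X a =>
    induction v using TensorProduct.induction_on with
    | zero => simp
    | add v v' h h' => simp only [map_add, LinearMap.add_apply, h, h']; abel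
    | tmul Y b =>
      rw [tensorPairing_tmul, tensorPairing_tmul, trForm_comm, angle_skew, smul_neg]

/-- Jacobi identity for three elements of `sl2 ⊗ A`, first component. -/
lemma jacobi_tensor (u v w : sl2 ⊗[ℂ] A) :
    tensorBracket u (tensorBracket v w) - innerAction (tensorPairing v w) u
      = tensorBracket (tensorBracket u v) w + innerAction (tensorPairing u v) w
        + (tensorBracket v (tensorBracket u w) - innerAction (tensorPairing u w) v) := by
  induction u using TensorProduct.induction_on with
  | zero => simp
  | add u u' h h' =>
    simp only [map_add, LinearMap.add_apply]
    linear_combination (norm := module) (1 : ℂ) • (h + h')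
  | tmul X a =>
    induction v using TensorProduct.induction_on with
    | zero => simp
    | add v v' h h' =>
      simp only [map_add, LinearMap.add_apply]
      linear_combination (norm := module) (1 : ℂ) • (h + h')
    | tmul Y b =>
      induction w using TensorProduct.induction_on with
      | zero => simp
      | add w w' h h' =>
        simp only [map_add, LinearMap.add_apply]
        linear_combination (norm := module) (1 : ℂ) • (h + h')
      | tmul Z c =>
        have e1 : ⁅X, ⁅Y, Z⁆⁆ = (2 * trForm X Y) • Z - (2 * trForm X Z) • Y := by
          rw [← lie_skew, sl2_lie_lie, trForm_comm Z X, trForm_comm Y X]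
          abel
        have e2 : ⁅Y, ⁅X, Z⁆⁆ = (2 * trForm X Y) • Z - (2 * trForm Y Z) • X := by
          rw [← lie_skew, sl2_lie_lie, trForm_comm Z Y]
          abel
        simp only [tensorBracket_tmul, tensorPairing_tmul, map_smul, LinearMap.smul_apply,
          innerAction_tmul, der_angle, e1, e2, sl2_lie_lie, TensorProduct.sub_tmul,
          TensorProduct.tmul_sub, ← TensorProduct.smul_tmul']
        simp only [mul_comm]
        module

/-- Jacobi identity for three elements of `sl2 ⊗ A`, second component. -/
lemma jacobi_pairing (u v w : sl2 ⊗[ℂ] A) :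
    tensorPairing u (tensorBracket v w)
      = tensorPairing (tensorBracket u v) w + tensorPairing v (tensorBracket u w) := by
  induction u using TensorProduct.induction_on with
  | zero => simp
  | add u u' h h' => simp only [map_add, LinearMap.add_apply, h, h']; abel
  | tmul X a =>
    induction v using TensorProduct.induction_on with
    | zero => simp
    | add v v' h h' => simp only [map_add, LinearMap.add_apply, h, h']; abel
    | tmul Y b =>
      induction w using TensorProduct.induction_on with
      | zero => simp
      | add w w' h h' => simp only [map_add, h, h']; abel
      | tmul Z c =>
        have e : trForm Y ⁅X, Z⁆ = - trForm X ⁅Y, Z⁆ := by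
          rw [← trForm_lie, ← trForm_lie, ← lie_skew, map_neg, LinearMap.neg_apply]
        have h1 := angle_cyclic a b c
        have h2 := angle_skew a (b * c)
        have h3 := angle_skew b (c * a)
        rw [tensorBracket_tmul, tensorBracket_tmul, tensorBracket_tmul, tensorPairing_tmul,
          tensorPairing_tmul, tensorPairing_tmul, e, trForm_lie, mul_comm a c]
        linear_combination (norm := module)
          (2 * trForm X ⁅Y, Z⁆) • (h2 + h3 - h1)

lemma innerAction_tensorBracket (p : InnerSpace A) (u v : sl2 ⊗[ℂ] A) :
    innerAction p (tensorBracket u v)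
      = tensorBracket (innerAction p u) v + tensorBracket u (innerAction p v) := by
  induction u using TensorProduct.induction_on with
  | zero => simp
  | add u u' h h' => simp only [map_add, LinearMap.add_apply, h, h']; abel
  | tmul X a =>
    induction v using TensorProduct.induction_on with
    | zero => simp
    | add v v' h h' => simp only [map_add, h, h']; abel
    | tmul Y b =>
      simp only [tensorBracket_tmul, innerAction_tmul, der_mul, TensorProduct.tmul_add]

lemma innerBracket_tensorPairing (p : InnerSpace A) (u v : sl2 ⊗[ℂ] A) :
    innerBracket p (tensorPairing u v)
      = tensorPairing (innerAction p u) v + tensorPairing u (innerAction p v) := by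
  induction u using TensorProduct.induction_on with
  | zero => simp
  | add u u' h h' => simp only [map_add, LinearMap.add_apply, h, h']; abel
  | tmul X a =>
    induction v using TensorProduct.induction_on with
    | zero => simp
    | add v v' h h' => simp only [map_add, h, h']; abel
    | tmul Y b =>
      simp only [tensorPairing_tmul, innerAction_tmul, map_smul, innerBracket_angle, smul_add]

lemma innerAction_innerBracket (p q : InnerSpace A) (u : sl2 ⊗[ℂ] A) :
    innerAction (innerBracket p q) u
      = innerAction p (innerAction q u) - innerAction q (innerAction p u) := by
  induction u using TensorProduct.induction_on with
  | zero => simp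
  | add u u' h h' => simp only [map_add, h, h']; abel
  | tmul X a => simp only [innerAction_tmul, der_innerBracket, TensorProduct.tmul_sub]

variable (A) in
/-- The underlying space `(sl2 ⊗ A) ⊕ ⟨A, A⟩` of the Tits-Kantor-Koecher algebra of the
Jordan algebra `A`. -/
def TKK : Type _ := (sl2 ⊗[ℂ] A) × InnerSpace A

namespace TKK

instance : AddCommGroup (TKK A) := inferInstanceAs (AddCommGroup ((sl2 ⊗[ℂ] A) × InnerSpace A))

instance : Module ℂ (TKK A) := inferInstanceAs (Module ℂ ((sl2 ⊗[ℂ] A) × InnerSpace A))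

/-- The element `X ⊗ a`. -/
def tensor (X : sl2) (a : A) : TKK A := (X ⊗ₜ[ℂ] a, 0)

/-- The element `⟨a, b⟩`. -/
def angle (a b : A) : TKK A := (0, BabyTKK.angle a b)

/-- The bracket, bilinear and skew-symmetric, determined by
`[X ⊗ a, Y ⊗ b] = [X, Y] ⊗ ab + 2 tr(X Y) ⟨a, b⟩`,
`[⟨a, b⟩, X ⊗ c] = X ⊗ [L_a, L_b] c` and
`[⟨a, b⟩, ⟨c, d⟩] = ⟨[L_a, L_b] c, d⟩ + ⟨c, [L_a, L_b] d⟩`. -/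
instance : Bracket (TKK A) (TKK A) where
  bracket x y :=
    (tensorBracket x.1 y.1 + innerAction x.2 y.1 - innerAction y.2 x.1,
      tensorPairing x.1 y.1 + innerBracket x.2 y.2)

lemma bracket_fst (x y : TKK A) :
    ⁅x, y⁆.1 = tensorBracket x.1 y.1 + innerAction x.2 y.1 - innerAction y.2 x.1 := rfl

lemma bracket_snd (x y : TKK A) :
    ⁅x, y⁆.2 = tensorPairing x.1 y.1 + innerBracket x.2 y.2 := rfl

lemma add_fst (x y : TKK A) : (x + y).1 = x.1 + y.1 := rfl

lemma add_snd (x y : TKK A) : (x + y).2 = x.2 + y.2 := rfl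

lemma smul_fst (r : ℂ) (x : TKK A) : (r • x).1 = r • x.1 := rfl

lemma smul_snd (r : ℂ) (x : TKK A) : (r • x).2 = r • x.2 := rfl

lemma eq_zero_of_eq_neg {M : Type*} [AddCommGroup M] [Module ℂ M] {x : M} (h : x = -x) :
    x = 0 := by
  have h2 : (2 : ℂ) • x = 0 := by
    rw [two_smul]
    nth_rewrite 2 [h]
    exact add_neg_cancel x
  exact (smul_eq_zero.mp h2).resolve_left two_ne_zero

instance : LieRing (TKK A) where
  add_lie x y z := by
    refine Prod.ext ?_ ?_
    · simp only [bracket_fst, add_fst, add_snd, map_add, LinearMap.add_apply]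
      abel
    · simp only [bracket_snd, add_fst, add_snd, map_add, LinearMap.add_apply]
      abel
  lie_add x y z := by
    refine Prod.ext ?_ ?_
    · simp only [bracket_fst, add_fst, add_snd, map_add, LinearMap.add_apply]
      abel
    · simp only [bracket_snd, add_fst, add_snd, map_add]
      abel
  lie_self x := by
    refine Prod.ext ?_ ?_
    · rw [bracket_fst, add_sub_cancel_right]
      exact eq_zero_of_eq_neg (tensorBracket_skew _ _)
    · rw [bracket_snd, eq_zero_of_eq_neg (tensorPairing_skew x.1 x.1),
        eq_zero_of_eq_neg (innerBracket_skew x.2 x.2)]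
      exact add_zero _
  leibniz_lie x y z := by
    refine Prod.ext ?_ ?_
    · have h := jacobi_tensor x.1 y.1 z.1
      simp only [bracket_fst, bracket_snd, add_fst, map_add, map_sub, LinearMap.add_apply,
        LinearMap.sub_apply, innerAction_tensorBracket, innerAction_innerBracket]
      rw [tensorBracket_skew (innerAction z.2 x.1) y.1]
      linear_combination (norm := module) (1 : ℂ) • h
    · have h := jacobi_pairing x.1 y.1 z.1
      have h' := innerBracket_jacobi x.2 y.2 z.2
      simp only [bracket_fst, bracket_snd, add_snd, map_add, map_sub, LinearMap.add_apply,
        LinearMap.sub_apply]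
      rw [innerBracket_skew (tensorPairing x.1 y.1) z.2]
      simp only [innerBracket_tensorPairing]
      rw [tensorPairing_skew (innerAction z.2 x.1) y.1]
      linear_combination (norm := module) (1 : ℂ) • (h + h')

instance : LieAlgebra ℂ (TKK A) where
  lie_smul r x y := by
    refine Prod.ext ?_ ?_
    · simp only [bracket_fst, smul_fst, smul_snd, map_smul, LinearMap.smul_apply, smul_add,
        smul_sub]
    · simp only [bracket_snd, smul_fst, smul_snd, map_smul, smul_add]

end TKK

end General

/-- The semi-lattice `S = 2ℤ² ∪ (e₁ + 2ℤ²) ∪ (e₂ + 2ℤ²)` of `ℤ²`. -/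
def S : Set (ℤ × ℤ) :=
  {ρ | (Even ρ.1 ∧ Even ρ.2) ∨ (Odd ρ.1 ∧ Even ρ.2) ∨ (Even ρ.1 ∧ Odd ρ.2)}

/-- The space `𝒥` with basis `x^ρ`, `ρ ∈ S`. -/
def J : Type := S →₀ ℂ

namespace J

instance : AddCommGroup J := inferInstanceAs (AddCommGroup (S →₀ ℂ))

instance : Module ℂ J := inferInstanceAs (Module ℂ (S →₀ ℂ))

/-- The basis of `𝒥` indexed by `S`. -/
def basis : Module.Basis S ℂ J := .ofRepr (LinearEquiv.refl ℂ (S →₀ ℂ))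

open Classical in
/-- The basis vector `x^ρ` for `ρ ∈ S`, and `0` for `ρ ∉ S`. -/
def x (ρ : ℤ × ℤ) : J := if h : ρ ∈ S then basis ⟨ρ, h⟩ else 0

/-- The bilinear product with `x^ρ · x^τ = x^(ρ+τ)` if `ρ + τ ∈ S`, and `0` otherwise. -/
def mulBilin : J →ₗ[ℂ] J →ₗ[ℂ] J :=
  basis.constr ℂ fun ρ : S => basis.constr ℂ fun τ : S => x (ρ.1 + τ.1)

instance : Mul J := ⟨fun a b => mulBilin a b⟩

lemma mul_def (a b : J) : a * b = mulBilin a b := rfl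

lemma x_of_notMem {ρ : ℤ × ℤ} (h : ρ ∉ S) : x ρ = 0 := dif_neg h

lemma x_of_mem {ρ : ℤ × ℤ} (h : ρ ∈ S) : x ρ = basis ⟨ρ, h⟩ := dif_pos h

lemma x_mul_x {ρ τ : ℤ × ℤ} (hρ : ρ ∈ S) (hτ : τ ∈ S) : x ρ * x τ = x (ρ + τ) := by
  rw [mul_def, mulBilin, x_of_mem hρ, x_of_mem hτ, Module.Basis.constr_basis,
    Module.Basis.constr_basis]

lemma induction {P : J → Prop} (a : J) (h0 : P 0) (hadd : ∀ a b, P a → P b → P (a + b))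
    (hx : ∀ ρ ∈ S, ∀ r : ℂ, P (r • x ρ)) : P a := by
  rw [← basis.linearCombination_repr a]
  refine Finsupp.induction_linear (basis.repr a) (by simpa using h0)
    (fun f g hf hg => by rw [map_add]; exact hadd _ _ hf hg) fun ρ r => ?_
  rw [Finsupp.linearCombination_single, ← x_of_mem ρ.2]
  exact hx ρ.1 ρ.2 r

lemma mul_comm' (a b : J) : a * b = b * a := by
  simp only [mul_def]
  induction a using J.induction with
  | h0 => simp
  | hadd a a' h h' => simp only [map_add, LinearMap.add_apply, h, h']
  | hx ρ hρ r =>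
    induction b using J.induction with
    | h0 => simp
    | hadd b b' h h' => simp only [map_add, LinearMap.add_apply, h, h']
    | hx τ hτ s =>
      simp only [map_smul, LinearMap.smul_apply]
      rw [← mul_def, ← mul_def, x_mul_x hρ hτ, x_mul_x hτ hρ, add_comm, smul_comm]

instance : NonUnitalNonAssocCommRing J where
  left_distrib a b c := map_add (mulBilin a) b c
  right_distrib a b c := LinearMap.map_add₂ mulBilin a b c
  zero_mul a := LinearMap.map_zero₂ mulBilin a
  mul_zero a := map_zero (mulBilin a)
  mul_comm := mul_comm'

instance : IsScalarTower ℂ J J := ⟨fun r a b => LinearMap.map_smul₂ mulBilin r a b⟩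

instance : SMulCommClass ℂ J J := ⟨fun r a b => (map_smul (mulBilin a) r b).symm⟩

/-- Parity test. -/
def par (n : ℤ) : Bool := decide (Even n)

lemma par_add (m n : ℤ) : par (m + n) = (par m == par n) := by
  by_cases hm : Even m <;> by_cases hn : Even n <;> simp [par, Int.even_add, hm, hn]

lemma mem_S_iff (ρ : ℤ × ℤ) : ρ ∈ S ↔ (par ρ.1 || par ρ.2) = true := by
  simp only [S, Set.mem_ofPred_eq, ← Int.not_even_iff_odd, par, Bool.or_eq_true,
    decide_eq_true_eq]
  tauto

lemma x_mul_x' (ρ τ : ℤ × ℤ) :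
    x ρ * x τ = (if (par ρ.1 || par ρ.2) && (par τ.1 || par τ.2)
      && ((par ρ.1 == par τ.1) || (par ρ.2 == par τ.2)) then 1 else 0 : ℕ) • x (ρ + τ) := by
  split_ifs with h
  · simp only [Bool.and_eq_true] at h
    rw [x_mul_x ((mem_S_iff _).2 h.1.1) ((mem_S_iff _).2 h.1.2), one_smul]
  · rw [zero_smul]
    by_cases hρ : ρ ∈ S
    · by_cases hτ : τ ∈ S
      · rw [x_mul_x hρ hτ, x_of_notMem fun hs => h ?_]
        rw [mem_S_iff] at hρ hτ hs
        rw [Prod.fst_add, Prod.snd_add, par_add, par_add] at hs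
        rw [hρ, hτ, hs]
        rfl
      · rw [x_of_notMem hτ, mul_zero]
    · rw [x_of_notMem hρ, zero_mul]

/-- The linearised Jordan identity on the basis. -/
lemma jordan_x {a b c d : ℤ × ℤ} (ha : a ∈ S) (hb : b ∈ S) (hc : c ∈ S) (hd : d ∈ S) :
    x a * x d * (x b * x c) + x b * x d * (x c * x a) + x c * x d * (x a * x b)
      = x a * (x d * (x b * x c)) + x b * (x d * (x c * x a)) + x c * (x d * (x a * x b)) := by
  have e1 : a + d + (b + c) = a + (d + (b + c)) := by abel
  have e2 : b + d + (c + a) = a + (d + (b + c)) := by abel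
  have e3 : c + d + (a + b) = a + (d + (b + c)) := by abel
  have e4 : b + (d + (c + a)) = a + (d + (b + c)) := by abel
  have e5 : c + (d + (a + b)) = a + (d + (b + c)) := by abel
  rw [x_mul_x ha hd, x_mul_x hb hc, x_mul_x hb hd, x_mul_x hc ha, x_mul_x hc hd, x_mul_x ha hb]
  rw [x_mul_x' (a + d), x_mul_x' (b + d), x_mul_x' (c + d), x_mul_x' d (b + c),
    x_mul_x' d (c + a), x_mul_x' d (a + b), e1, e2, e3]
  rw [mul_smul_comm, mul_smul_comm, mul_smul_comm]
  rw [x_mul_x' a (d + (b + c)), x_mul_x' b (d + (c + a)), x_mul_x' c (d + (a + b)), e4, e5]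
  rw [smul_smul, smul_smul, smul_smul, ← add_smul, ← add_smul, ← add_smul, ← add_smul]
  rw [mem_S_iff] at ha hb hc hd
  congr 1
  simp only [Prod.fst_add, Prod.snd_add, par_add]
  generalize par a.1 = a1 at *
  generalize par a.2 = a2 at *
  generalize par b.1 = b1 at *
  generalize par b.2 = b2 at *
  generalize par c.1 = c1 at *
  generalize par c.2 = c2 at *
  generalize par d.1 = d1 at *
  generalize par d.2 = d2 at *
  clear e1 e2 e3 e4 e5
  revert a1 a2 b1 b2 c1 c2 d1 d2
  decide

instance : IsCommJordan J where
  lmul_comm_rmul_rmul a d := by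
    have key : ∀ a b c d : J,
        a * d * (b * c) + b * d * (c * a) + c * d * (a * b)
          = a * (d * (b * c)) + b * (d * (c * a)) + c * (d * (a * b)) := by
      intro a b c d
      induction a using J.induction with
      | h0 => simp
      | hadd a a' h h' =>
        simp only [add_mul, mul_add]
        linear_combination (norm := module) (1 : ℂ) • (h + h')
      | hx ρ hρ r =>
      induction b using J.induction with
      | h0 => simp
      | hadd a a' h h' =>
        simp only [add_mul, mul_add]
        linear_combination (norm := module) (1 : ℂ) • (h + h')
      | hx ρ₂ hρ₂ r₂ =>
      induction c using J.induction with
      | h0 => simp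
      | hadd a a' h h' =>
        simp only [add_mul, mul_add]
        linear_combination (norm := module) (1 : ℂ) • (h + h')
      | hx ρ₃ hρ₃ r₃ =>
      induction d using J.induction with
      | h0 => simp
      | hadd a a' h h' =>
        simp only [add_mul, mul_add]
        linear_combination (norm := module) (1 : ℂ) • (h + h')
      | hx ρ₄ hρ₄ r₄ =>
        simp only [smul_mul_assoc, mul_smul_comm]
        linear_combination (norm := module) (r * r₂ * r₃ * r₄) • jordan_x hρ hρ₂ hρ₃ hρ₄
    linear_combination (norm := module) (1 / 3 : ℂ) • key a a a d

end J

/-- The baby Tits-Kantor-Koecher algebra `(sl2 ⊗ 𝒥) ⊕ ⟨𝒥, 𝒥⟩`. -/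
abbrev G : Type := TKK J

/-- The Chevalley generator `x₊` of `sl2`, the elementary matrix `E₁₂`. -/
def ePlus : sl2 := LieAlgebra.SpecialLinear.single 0 1 (by decide) 1

/-- The Chevalley generator `x₋` of `sl2`, the elementary matrix `E₂₁`. -/
def eMinus : sl2 := LieAlgebra.SpecialLinear.single 1 0 (by decide) 1

/-- The coroot `α^∨ = [x₊, x₋] = E₁₁ - E₂₂` of `sl2`. -/
def coroot : sl2 := LieAlgebra.SpecialLinear.singleSubSingle 0 1 1

/-- `x₊(m, n)`; it is `0` for `(m, n) ∉ S`. -/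
def xPlus (m n : ℤ) : G := TKK.tensor ePlus (J.x (m, n))

/-- `x₋(m, n)`; it is `0` for `(m, n) ∉ S`. -/
def xMinus (m n : ℤ) : G := TKK.tensor eMinus (J.x (m, n))

open Classical in
/-- `α^∨(m, n)`, which is `α^∨ ⊗ x^(m,n)` if `(m, n) ∈ S`, and `2⟨x^(1,0), x^(m-1,n)⟩` if not. -/
def alphaVee (m n : ℤ) : G :=
  if (m, n) ∈ S then TKK.tensor coroot (J.x (m, n))
  else (2 : ℂ) • TKK.angle (J.x (1, 0)) (J.x (m - 1, n))

/-- `C₁(m, n)`, which is `⟨x^(1,0), x^(m-1,n)⟩` if `m` and `n` are even, and `0` if not. -/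
def C₁ (m n : ℤ) : G :=
  if Even m ∧ Even n then TKK.angle (J.x (1, 0)) (J.x (m - 1, n)) else 0

/-- `C₂(m, n)`, which is `⟨x^(0,1), x^(m,n-1)⟩` if `m` and `n` are even, and `0` if not. -/
def C₂ (m n : ℤ) : G :=
  if Even m ∧ Even n then TKK.angle (J.x (0, 1)) (J.x (m, n - 1)) else 0

section Modules

variable (W : Type*) [AddCommGroup W] [Module ℂ W] [LieRingModule G W] [LieModule ℂ G W]

/-- The module `W` is of level `ℓ`: the element `2 C₁ = 2 C₁(0, 0)` acts as the scalar `ℓ`. -/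
def IsOfLevel (ℓ : ℂ) : Prop :=
  ∀ w : W, ⁅(2 : ℂ) • C₁ 0 0, w⁆ = ℓ • w

open Filter in
/-- The module `W` is restricted. -/
def IsRestricted : Prop :=
  ∀ (w : W) (n : ℤ),
    (∀ᶠ m : ℤ in atTop, ⁅xPlus m n, w⁆ = 0) ∧
    (∀ᶠ m : ℤ in atTop, ⁅xMinus m n, w⁆ = 0) ∧
    (∀ᶠ m : ℤ in atTop, ⁅alphaVee m n, w⁆ = 0) ∧
    (∀ s : ℤ, s ≠ 0 → ∀ᶠ m : ℤ in atTop, ⁅C₁ (2 * m) (2 * s), w⁆ = 0) ∧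
    (∀ᶠ m : ℤ in atTop, ⁅C₂ (2 * m) 0, w⁆ = 0)

/-- The operator by which an element of the algebra acts on `W`. -/
abbrev act (g : G) : Module.End ℂ W := LieModule.toEnd ℂ G W g

/-- The module `W` is integrable: for `(m, n) ∈ S`, the elements `x₊(m, n)` and `x₋(m, n)` act
locally nilpotently. -/
def IsIntegrable : Prop :=
  ∀ m n : ℤ, (m, n) ∈ S →
    (∀ w : W, ∃ k : ℕ, (act W (xPlus m n) ^ k) w = 0) ∧
    (∀ w : W, ∃ k : ℕ, (act W (xMinus m n) ^ k) w = 0)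

variable {W}

/-- A family `X : ℤ → End W` stands for the formal series `X(z) = ∑ₘ X m z^(-m-1)`. This says
that the power `X(z)^k` is defined on `W` and is zero: for each `N` and `w`, the coefficient
`∑ X m₁ ⋯ X mₖ w` of `z^(-N-k)`, over all `(m₁, …, mₖ)` with `m₁ + ⋯ + mₖ = N`, has only finitely
many nonzero terms and is equal to `0`. -/
def SeriesPowEqZero (X : ℤ → Module.End ℂ W) (k : ℕ) : Prop :=
  ∀ (N : ℤ) (w : W),
    {m : Fin k → ℤ | ∑ i, m i = N ∧ (List.ofFn fun i => X (m i)).prod w ≠ 0}.Finite ∧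
    ∑ᶠ m ∈ {m : Fin k → ℤ | ∑ i, m i = N}, (List.ofFn fun i => X (m i)).prod w = 0

variable (W)

/-- The coefficients of `x₊(z, n) = ∑ₘ x₊(m, n) z^(-m-1)` on `W`. -/
def seriesPlus (n : ℤ) : ℤ → Module.End ℂ W := fun m => act W (xPlus m n)

/-- The coefficients of `x₋(z, n) = ∑ₘ x₋(m, n) z^(-m-1)` on `W`. -/
def seriesMinus (n : ℤ) : ℤ → Module.End ℂ W := fun m => act W (xMinus m n)

end Modules

end BabyTKK

end

open scoped TensorProduct

noncomputable section

namespace BabyTKK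

open Filter

/-! ### Powers of a commuting field of operators -/

section Series

variable {W : Type*} [AddCommGroup W] [Module ℂ W]

/-! The algebra is cut into rows. For fixed `a`, the elements `x₊(m, a)` and `x₋(m, -a)` with `m ∈
dℤ` satisfy the relations of affine `sl₂` in the loop index `m / d`, with central charge `d ℓ`
(`affineSl2_row`). Here `d = 1` for even `a`. For odd `a` one takes `d = 2`, because `(m, a) ∈ S`
forces `m` to be even; this doubling of the level is why the exponent is `2ℓ + 1` on odd rows. The
proposition thus reduces to affine `sl₂`.

Integrable implies the relations. On an integrable module the charge `c` is a natural number `k`: a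
highest weight vector for the horizontal `sl₂`, tested against the triples `(e m, f (-m), h 0 + m
c)` for large `m`, has weights `μ + m c` that must all be natural numbers (`level_nat`). To obtain
`e(z)^(k+1) = 0`, compute the commutator of `f` with `e(z)^r`. Its double-pole part carries the
factor `r (c - r + 1)`, which vanishes for `r = k + 1`, so `[f p, R N]` depends only on `p + N`,
where `R N` are the coefficients of `e(z)^(k+1)` (`f_R_sub`, `f_R`). Hence the vectors killed by all
`R N (f 0)^i` form a submodule `K`. If `K` were proper, the quotient would contain a nonzero vector
killed by all modes of positive index and of horizontal weight `j ≤ k` (`exists_highest_lowered`).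
For a lift `v`, the vectors `R N (f 0)^i v` vanish for large `N`. Descending in `N`, a nonzero one
would be a highest weight vector for the affine simple root with negative weight, contradicting
local nilpotency of `e (-1)`. So `v ∈ K`, which is absurd (`R_level_succ_eq_zero`).

The relations imply integrable. If `X(z)^k = 0`, the coefficient of index `k m` expresses `(X m)^k`
through products containing some `X j` with `j > m`. Descending induction on `m` in a commutative
algebra makes every `X m` locally nilpotent (`locNilp_of_seriesPowEqZero`). -/

/-- The coefficient `∑ X m₁ ⋯ X mᵣ w`, over `m₁ + ⋯ + mᵣ = N`, of the series `X(z)^r w`. -/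
def powCoeff (X : ℤ → Module.End ℂ W) (r : ℕ) (N : ℤ) (w : W) : W :=
  ∑ᶠ m ∈ {m : Fin r → ℤ | ∑ i, m i = N}, (List.ofFn fun i => X (m i)).prod w

omit [Module ℂ W] in
lemma eventually_finsum_eq_sum_Ico {g : ℤ → W} (hfin : (Function.support g).Finite) :
    ∀ᶠ b : ℤ in atTop, ∑ᶠ m, g m = ∑ m ∈ Finset.Ico (-b) b, g m := by
  obtain ⟨B, hB⟩ := hfin.bddAbove
  obtain ⟨A, hA⟩ := hfin.bddBelow
  filter_upwards [eventually_gt_atTop B, eventually_ge_atTop (-A)] with b hb hb'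
  refine finsum_eq_sum_of_support_subset _ fun m hm => ?_
  have h1 := hB hm
  have h2 := hA hm
  rw [Finset.coe_Ico]
  exact ⟨by linarith, by linarith⟩

omit [Module ℂ W] in
lemma sum_Ico_sub (g : ℤ → W) {a b : ℤ} (hab : a ≤ b) :
    ∑ m ∈ Finset.Ico a b, (g m - g (m + 1)) = g a - g b := by
  induction b, hab using Int.leInduction with
  | base => simp
  | succ b hb ih =>
    rw [← Finset.insert_Ico_right_eq_Ico_add_one hb, Finset.sum_insert (by simp), ih]
    abel

/-- A commuting family of operators, each vector being killed by almost all the operators of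
positive index. -/
structure IsCommutingField (X : ℤ → Module.End ℂ W) : Prop where
  comm : ∀ m n, Commute (X m) (X n)
  lower : ∀ w, ∀ᶠ m in atTop, X m w = 0

namespace IsCommutingField

variable {X : ℤ → Module.End ℂ W} (hX : IsCommutingField X)
include hX

lemma exists_bound (w : W) : ∃ M : ℤ, 0 ≤ M ∧ ∀ m, M < m → X m w = 0 := by
  obtain ⟨M, hM⟩ := eventually_atTop.1 (hX.lower w)
  exact ⟨max M 0, le_max_right _ _, fun m hm => hM m ((le_max_left _ _).trans hm.le)⟩

/-- The factors commute, so the one killing `w` can be applied first. -/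
lemma ofFn_prod_eq_zero {r : ℕ} (m : Fin r → ℤ) (w : W) (i : Fin r) (hi : X (m i) w = 0) :
    (List.ofFn fun i => X (m i)).prod w = 0 := by
  induction r with
  | zero => exact i.elim0
  | succ r ih =>
    rw [List.ofFn_succ, List.prod_cons, Module.End.mul_apply]
    induction i using Fin.cases with
    | zero =>
      have h : Commute (X (m 0)) (List.ofFn fun i : Fin r => X (m i.succ)).prod := by
        refine Commute.list_prod_right _ _ fun y hy => ?_
        obtain ⟨j, rfl⟩ := (List.mem_ofFn' _ _).1 hy
        exact hX.comm _ _
      rw [← Module.End.mul_apply, h.eq, Module.End.mul_apply, hi, map_zero]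
    | succ i => rw [ih (fun j => m j.succ) i hi, map_zero]

/-- A nonzero term has all its indices at most `M`; with the sum fixed, each index is then also
bounded below. -/
lemma finite_ofFn_prod_ne_zero (r : ℕ) (N : ℤ) (w : W) :
    {m : Fin r → ℤ | ∑ i, m i = N ∧ (List.ofFn fun i => X (m i)).prod w ≠ 0}.Finite := by
  obtain ⟨M, hM0, hM⟩ := hX.exists_bound w
  refine (Set.Finite.pi' fun _ : Fin r => Set.finite_Icc (N - r * M) M).subset ?_
  rintro m ⟨hsum, hne⟩ i
  have hle (j : Fin r) : m j ≤ M := by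
    by_contra! hj
    exact hne (hX.ofFn_prod_eq_zero m w j (hM _ hj))
  refine ⟨?_, hle i⟩
  have h1 := Finset.add_sum_erase Finset.univ m (Finset.mem_univ i)
  have h2 : ∑ j ∈ Finset.univ.erase i, m j ≤ ∑ j ∈ Finset.univ.erase i, M :=
    Finset.sum_le_sum fun j _ => hle j
  have h3 : ∑ j ∈ Finset.univ.erase i, M ≤ ∑ j : Fin r, M :=
    Finset.sum_le_sum_of_subset_of_nonneg (Finset.erase_subset _ _) fun _ _ _ => hM0
  simp only [Finset.sum_const, Finset.card_univ, Fintype.card_fin, nsmul_eq_mul] at h2 h3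
  linarith

lemma seriesPowEqZero_iff (r : ℕ) :
    SeriesPowEqZero X r ↔ ∀ N w, powCoeff X r N w = 0 :=
  forall₂_congr fun N w => and_iff_right (hX.finite_ofFn_prod_ne_zero r N w)

omit hX in
lemma powCoeff_zero (N : ℤ) (w : W) : powCoeff X 0 N w = if N = 0 then w else 0 := by
  rw [powCoeff, finsum_mem_def, finsum_eq_single _ ![] fun m hm => (hm (Subsingleton.elim _ _)).elim]
  simp [Set.indicator_apply, eq_comm]

lemma powCoeff_eq_zero_of_lt {w : W} {M : ℤ} (hM : ∀ m, M < m → X m w = 0) (r : ℕ) {N : ℤ}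
    (hN : r * M < N) : powCoeff X r N w = 0 := by
  refine finsum_mem_eq_zero_of_forall_eq_zero fun m hm => ?_
  by_contra hne
  have hle (j : Fin r) : m j ≤ M := by
    by_contra! hj
    exact hne (hX.ofFn_prod_eq_zero m w j (hM _ hj))
  have h := Finset.sum_le_sum fun j (_ : j ∈ Finset.univ) => hle j
  simp only [Finset.sum_const, Finset.card_univ, Fintype.card_fin, nsmul_eq_mul] at h
  have hm' : ∑ i, m i = N := hm
  linarith

lemma eventually_powCoeff_eq_zero (r : ℕ) (w : W) : ∀ᶠ N in atTop, powCoeff X r N w = 0 := by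
  obtain ⟨M, -, hM⟩ := hX.exists_bound w
  filter_upwards [eventually_gt_atTop (r * M)] with N hN
  exact hX.powCoeff_eq_zero_of_lt hM r hN

lemma powCoeff_succ (r : ℕ) (N : ℤ) (w : W) :
    powCoeff X (r + 1) N w = ∑ᶠ m, X m (powCoeff X r (N - m) w) := by
  rw [powCoeff, finsum_mem_def, ← finsum_comp_equiv (Fin.consEquiv fun _ => ℤ), finsum_curry]
  · refine finsum_congr fun m => ?_
    rw [powCoeff, finsum_mem_def, map_finsum]
    · refine finsum_congr fun m' => ?_
      have h : Fin.cons m m' ∈ {m : Fin (r + 1) → ℤ | ∑ i, m i = N}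
          ↔ m' ∈ {l : Fin r → ℤ | ∑ i, l i = N - m} := by
        simp only [Set.mem_ofPred_eq, Fin.sum_cons]
        constructor <;> intro h <;> linarith
      by_cases hm' : m' ∈ {l : Fin r → ℤ | ∑ i, l i = N - m}
      · rw [Set.indicator_of_mem hm', Fin.consEquiv]
        refine (Set.indicator_of_mem (h.2 hm') _).trans ?_
        simp [List.ofFn_succ]
      · rw [Set.indicator_of_notMem hm', map_zero]
        exact Set.indicator_of_notMem (fun h' => hm' (h.1 h')) _
    · refine (hX.finite_ofFn_prod_ne_zero r (N - m) w).subset fun m' hm' => ?_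
      simpa [Set.indicator_apply] using hm'
  · refine Set.Finite.subset ((hX.finite_ofFn_prod_ne_zero (r + 1) N w).preimage
      (Fin.consEquiv fun _ => ℤ).injective.injOn) fun m' hm' => ?_
    simpa [Set.indicator_apply] using hm'

lemma apply_powCoeff (n : ℤ) (r : ℕ) (N : ℤ) (w : W) :
    X n (powCoeff X r N w) = powCoeff X r N (X n w) := by
  have hc (m : Fin r → ℤ) : Commute (X n) (List.ofFn fun i => X (m i)).prod := by
    refine Commute.list_prod_right _ _ fun y hy => ?_
    obtain ⟨j, rfl⟩ := (List.mem_ofFn' _ _).1 hy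
    exact hX.comm _ _
  rw [powCoeff, powCoeff]
  refine (AddMonoidHom.map_finsum_mem' (X n).toAddMonoidHom
    ((hX.finite_ofFn_prod_ne_zero r N w).subset fun m hm => hm)).trans ?_
  exact finsum_mem_congr rfl fun m _ => LinearMap.congr_fun (hc m) w

lemma powCoeff_add (r : ℕ) (N : ℤ) (v w : W) :
    powCoeff X r N (v + w) = powCoeff X r N v + powCoeff X r N w := by
  simp only [powCoeff, map_add]
  exact finsum_mem_add_distrib' ((hX.finite_ofFn_prod_ne_zero r N v).subset fun m hm => hm)
    ((hX.finite_ofFn_prod_ne_zero r N w).subset fun m hm => hm)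

lemma powCoeff_smul (r : ℕ) (N : ℤ) (a : ℂ) (w : W) :
    powCoeff X r N (a • w) = a • powCoeff X r N w := by
  simp only [powCoeff, map_smul]
  refine (AddMonoidHom.map_finsum_mem' (DistribSMul.toAddMonoidHom W a)
    ((hX.finite_ofFn_prod_ne_zero r N w).subset fun m hm => hm)).symm

/-- The coefficients of the powers of a commuting field, as linear operators. -/
def pow (r : ℕ) (N : ℤ) : Module.End ℂ W where
  toFun := powCoeff X r N
  map_add' := hX.powCoeff_add r N
  map_smul' := hX.powCoeff_smul r N

lemma apply_pow (n : ℤ) (r : ℕ) (N : ℤ) (w : W) :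
    X n (hX.pow r N w) = hX.pow r N (X n w) :=
  hX.apply_powCoeff n r N w

lemma eventually_pow_eq_zero (r : ℕ) (w : W) : ∀ᶠ N in atTop, hX.pow r N w = 0 :=
  hX.eventually_powCoeff_eq_zero r w

lemma pow_zero (N : ℤ) (w : W) : hX.pow 0 N w = if N = 0 then w else 0 := powCoeff_zero N w

lemma finite_support_pow (r : ℕ) (N : ℤ) (w : W) :
    (Function.support fun m => X m (hX.pow r (N - m) w)).Finite := by
  obtain ⟨M, -, hM⟩ := hX.exists_bound w
  refine (Set.finite_Icc (N - r * M) M).subset fun m hm => ⟨?_, ?_⟩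
  · by_contra! h
    refine hm ?_
    change X m (powCoeff X r (N - m) w) = 0
    rw [hX.powCoeff_eq_zero_of_lt hM r (by linarith), map_zero]
  · by_contra! h
    exact hm (by simp only [hX.apply_pow, hM m h, map_zero])

lemma pow_succ (r : ℕ) (N : ℤ) (w : W) :
    hX.pow (r + 1) N w = ∑ᶠ m, X m (hX.pow r (N - m) w) := hX.powCoeff_succ r N w

/-- Since every large window works, one `b` serves several series at once, and identities between
infinite sums become termwise identities of finite ones. -/
lemma eventually_pow_succ (r : ℕ) (N : ℤ) (w : W) :
    ∀ᶠ b : ℤ in atTop,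
      hX.pow (r + 1) N w = ∑ m ∈ Finset.Ico (-b) b, X m (hX.pow r (N - m) w) := by
  rw [pow_succ]
  exact eventually_finsum_eq_sum_Ico (hX.finite_support_pow r N w)

end IsCommutingField

/-! ### Affine `sl₂` relations and commutators with `e(z)^r` -/

/-- The operators of a module for the affine Lie algebra of type `A₁` on which the central element
acts as the scalar `c`; no local nilpotency is required. -/
structure AffineSl2 (c : ℂ) (e f h : ℤ → Module.End ℂ W) : Prop where
  ee : ∀ m n w, e m (e n w) = e n (e m w)
  ff : ∀ m n w, f m (f n w) = f n (f m w)
  ef : ∀ m n w, e m (f n w) = f n (e m w) + h (m + n) w + (if m + n = 0 then m * c else 0) • w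
  he : ∀ m n w, h m (e n w) = e n (h m w) + (2 : ℂ) • e (m + n) w
  hf : ∀ m n w, h m (f n w) = f n (h m w) - (2 : ℂ) • f (m + n) w
  e_lower : ∀ w, ∀ᶠ m in atTop, e m w = 0
  f_lower : ∀ w, ∀ᶠ m in atTop, f m w = 0

namespace AffineSl2

variable {c : ℂ} {e f h : ℤ → Module.End ℂ W} (A : AffineSl2 c e f h)
include A

lemma isCommutingField : IsCommutingField e :=
  ⟨fun m n => LinearMap.ext (A.ee m n), A.e_lower⟩

/-- The coefficients of `e(z)^r`. -/
def R (r : ℕ) (N : ℤ) : Module.End ℂ W := A.isCommutingField.pow r N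

lemma e_R (n : ℤ) (r : ℕ) (N : ℤ) (w : W) : e n (A.R r N w) = A.R r N (e n w) :=
  A.isCommutingField.apply_pow n r N w

lemma eventually_R_eq_zero (r : ℕ) (w : W) : ∀ᶠ N in atTop, A.R r N w = 0 :=
  A.isCommutingField.eventually_pow_eq_zero r w

lemma R_zero (N : ℤ) (w : W) : A.R 0 N w = if N = 0 then w else 0 :=
  A.isCommutingField.pow_zero N w

lemma eventually_R_succ (r : ℕ) (N : ℤ) (w : W) :
    ∀ᶠ b : ℤ in atTop, A.R (r + 1) N w = ∑ m ∈ Finset.Ico (-b) b, e m (A.R r (N - m) w) :=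
  A.isCommutingField.eventually_pow_succ r N w

lemma R_succ_eq_finsum (r : ℕ) (N : ℤ) (w : W) :
    A.R (r + 1) N w = ∑ᶠ m, e m (A.R r (N - m) w) :=
  A.isCommutingField.pow_succ r N w

/-- The central term vanishes in both cases of the `if`. Vanishing and stability properties of `h`
are thereby inherited from `e` and `f`. -/
lemma h_eq (m : ℤ) (w : W) : h m w = e m (f 0 w) - f 0 (e m w) := by
  rw [A.ef m 0 w, add_zero]
  split_ifs with hm
  · rw [hm]; simp
  · simp

lemma h_lower (w : W) : ∀ᶠ m in atTop, h m w = 0 := by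
  filter_upwards [A.e_lower w, A.e_lower (f 0 w)] with m h1 h2
  rw [A.h_eq, h1, h2, map_zero, sub_zero]

lemma hh (m n : ℤ) (w : W) :
    h m (h n w) = h n (h m w) + (if m + n = 0 then 2 * m * c else 0) • w := by
  have e1 := A.h_eq n w
  have e2 := A.h_eq n (h m w)
  have e3 := A.he m n (f 0 w)
  have e4 := A.hf m 0 (e n w)
  have e5 := A.hf m 0 w
  have e6 := A.he m n w
  have e7 := A.ef (m + n) 0 w
  have e8 := A.ef n m w
  rw [add_comm n m] at e8
  simp only [add_zero] at e4 e5 e7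
  rw [e1, e2, map_sub, e3, e4, e5, e6, map_sub, map_add, map_smul, map_smul, e7, e8]
  by_cases h0 : m + n = 0
  · have hn : (n : ℂ) = - m := by
      rw [eq_neg_iff_add_eq_zero, add_comm]
      exact_mod_cast h0
    simp only [h0, if_true, hn, Int.cast_zero, zero_mul]
    module
  · simp only [h0, if_false]
    module

lemma h_R (p : ℤ) (r : ℕ) (N : ℤ) (w : W) :
    h p (A.R r N w) = A.R r N (h p w) + (2 * r : ℂ) • A.R r (N + p) w := by
  induction r generalizing N w with
  | zero =>
    simp only [R_zero]
    split_ifs <;> simp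
  | succ r ih =>
    have h4 : A.R (r + 1) (N + p) w = ∑ᶠ m, e (p + m) (A.R r (N - m) w) := by
      rw [R_succ_eq_finsum, ← finsum_comp_equiv (Equiv.addLeft p)]
      simp [sub_add_eq_sub_sub]
    have h5 : (Function.support fun m => e (p + m) (A.R r (N - m) w)).Finite := by
      refine ((A.isCommutingField.finite_support_pow r (N + p) w).preimage
        (Equiv.addLeft p).injective.injOn).subset fun m hm => ?_
      simpa [R, sub_add_eq_sub_sub] using hm
    obtain ⟨b, h1, h2, h3, h6⟩ := ((A.eventually_R_succ r N w).and
      ((A.eventually_R_succ r N (h p w)).and ((A.eventually_R_succ r (N + p) w).and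
      (eventually_finsum_eq_sum_Ico h5)))).exists
    have h7 : (2 * ((r + 1 : ℕ) : ℂ)) • A.R (r + 1) (N + p) w
        = (2 * r : ℂ) • A.R (r + 1) (N + p) w
          + (2 : ℂ) • ∑ m ∈ Finset.Ico (-b) b, e (p + m) (A.R r (N - m) w) := by
      rw [← h6, ← h4]
      push_cast
      module
    rw [h7, h1, h2, h3, map_sum, Finset.smul_sum, Finset.smul_sum, ← Finset.sum_add_distrib,
      ← Finset.sum_add_distrib]
    refine Finset.sum_congr rfl fun m _ => ?_
    rw [A.he, ih, map_add, map_smul, add_assoc, sub_add_eq_add_sub]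

/-- Induction on `r`, peeling off one factor `e m`. The commutators `[e, f]` telescope over a finite
window, but the boundary term at `b` survives because `h` does not commute with `e(z)^r`: it
contributes `-2r`. The central term contributes `c`, and `r (c - r + 1) - 2r + c = (r + 1)(c - r)`.
-/
lemma f_R_sub (r : ℕ) (p N : ℤ) (w : W) :
    (f (p + 1) (A.R r N w) - A.R r N (f (p + 1) w))
        - (f p (A.R r (N + 1) w) - A.R r (N + 1) (f p w))
      = (r * (c - r + 1) : ℂ) • A.R (r - 1) (N + 1 + p) w := by
  induction r generalizing N w with
  | zero =>
    simp only [R_zero]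
    split_ifs <;> simp
  | succ r ih =>
    -- For `r = 0` the truncated index `r - 1` is harmless, since its coefficient is zero.
    have hih : ∀ᶠ b in atTop, ∑ m ∈ Finset.Ico (-b) b,
        e m ((r * (c - r + 1) : ℂ) • A.R (r - 1) (N - m + 1 + p) w)
          = (r * (c - r + 1) : ℂ) • A.R r (N + 1 + p) w := by
      cases r with
      | zero => simp
      | succ r =>
        filter_upwards [A.eventually_R_succ r (N + 1 + p) w] with b hb
        rw [hb, Finset.smul_sum]
        refine Finset.sum_congr rfl fun m _ => ?_
        rw [map_smul, Nat.add_sub_cancel]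
        congr 4
        ring
    have t1 : Tendsto (fun b : ℤ => N + 1 + b) atTop atTop :=
      tendsto_atTop_add_const_left _ _ tendsto_id
    have t2 : Tendsto (fun b : ℤ => b + p) atTop atTop :=
      tendsto_atTop_add_const_right _ _ tendsto_id
    obtain ⟨b, h0, h1, h2, h3, h4, h5, h6, h7⟩ := (hih.and ((A.eventually_R_succ r N w).and
      ((A.eventually_R_succ r N (f (p + 1) w)).and ((A.eventually_R_succ r (N + 1) w).and
      ((A.eventually_R_succ r (N + 1) (f p w)).and
      ((t1.eventually (A.eventually_R_eq_zero r w)).and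
      ((t2.eventually (A.h_lower w)).and (eventually_gt_atTop (|p| + 1))))))))).exists
    -- Up to the central mismatch treated in `hc`, the two commutators produced by `e m` are `g m`
    -- and `g (m + 1)`.
    let g (m : ℤ) : W := h (m + p) (A.R r (N + 1 - m) w)
      + (if m + p = 0 then m * c else 0) • A.R r (N + 1 - m) w
    have hp := abs_lt.1 (lt_trans (lt_add_one _) h7)
    have hp' := abs_lt.1 (show |p| < b - 1 by linarith)
    have hg : ∑ m ∈ Finset.Ico (-b) b, (g m - g (m + 1))
        = -((2 * r : ℂ) • A.R r (N + 1 + p) w) := by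
      rw [sum_Ico_sub g (by linarith)]
      simp only [g]
      rw [sub_neg_eq_add, h5, map_zero, smul_zero, if_neg (by omega), zero_smul, A.h_R, h6,
        map_zero]
      rw [show N + 1 - b + (b + p) = N + 1 + p by ring]
      module
    -- The central term of `[e m, f (p + 1)]` has coefficient `m c`, whereas `g (m + 1)` contains
    -- `(m + 1) c`; the discrepancy is one `c`, at `m = -1 - p`.
    have hc : ∑ m ∈ Finset.Ico (-b) b, (if m + 1 + p = 0 then c else 0) • A.R r (N - m) w
        = c • A.R r (N + 1 + p) w := by
      rw [Finset.sum_eq_single (-1 - p)]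
      · rw [if_pos (by ring)]
        congr 3
        ring
      · intro m _ hm
        rw [if_neg (by omega), zero_smul]
      · intro hm
        exact (hm (Finset.mem_Ico.2 ⟨by linarith, by linarith⟩)).elim
    have hr : ((r + 1 : ℕ) * (c - (r + 1 : ℕ) + 1) : ℂ) • A.R r (N + 1 + p) w
        = (r * (c - r + 1) : ℂ) • A.R r (N + 1 + p) w + -((2 * r : ℂ) • A.R r (N + 1 + p) w)
          + c • A.R r (N + 1 + p) w := by
      push_cast
      module
    rw [Nat.add_sub_cancel, hr, ← h0, ← hg, ← hc, h1, h2, h3, h4, map_sum, map_sum,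
      ← Finset.sum_sub_distrib, ← Finset.sum_sub_distrib, ← Finset.sum_sub_distrib,
      ← Finset.sum_add_distrib, ← Finset.sum_add_distrib]
    refine Finset.sum_congr rfl fun m _ => ?_
    have i1 := ih (N - m) w
    have i2 := A.ef m (p + 1) (A.R r (N - m) w)
    have i3 := A.ef m p (A.R r (N + 1 - m) w)
    rw [← i1]
    have n1 : N - m + 1 = N + 1 - m := by ring
    have n2 : N + 1 - (m + 1) = N - m := by ring
    have n3 : m + (p + 1) = m + 1 + p := by ring
    simp only [g, n1, n2]
    rw [n3] at i2
    simp only [map_sub, i2, i3]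
    split_ifs <;> push_cast <;> module

/-- At level `k` the operators `f p` and `e(z)^(k+1)` commute up to the field `[f 0, e(z)^(k+1)]`,
with a pole of order one only. -/
lemma f_R {k : ℕ} (hk : c = k) (p N : ℤ) (w : W) :
    f p (A.R (k + 1) N w) = A.R (k + 1) N (f p w)
      + (f 0 (A.R (k + 1) (N + p) w) - A.R (k + 1) (N + p) (f 0 w)) := by
  have step (p N : ℤ) (w : W) : f (p + 1) (A.R (k + 1) N w) - A.R (k + 1) N (f (p + 1) w)
      = f p (A.R (k + 1) (N + 1) w) - A.R (k + 1) (N + 1) (f p w) := by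
    have := A.f_R_sub (k + 1) p N w
    have hz : ((k + 1 : ℕ) * (c - (k + 1 : ℕ) + 1) : ℂ) = 0 := by
      rw [hk]
      push_cast
      ring
    rwa [hz, zero_smul, sub_eq_zero] at this
  rw [← sub_eq_iff_eq_add']
  induction p generalizing N with
  | zero => simp
  | succ p ih =>
    rw [step, ih, add_assoc, add_comm (1 : ℤ)]
  | pred p ih =>
    have := step (-p - 1) (N - 1) w
    rw [sub_add_cancel, sub_add_cancel] at this
    rw [← this, ih, show N - 1 + -(p : ℤ) = N + (-p - 1) by ring]

end AffineSl2
end Series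

/-! ### Locally nilpotent actions of `sl₂` -/

section Sl2

variable {W : Type*} [AddCommGroup W] [Module ℂ W]

lemma exists_pow_apply_ne_zero {T : Module.End ℂ W}
    {w : W} (hw : w ≠ 0) (hT : ∃ n : ℕ, (T ^ n) w = 0) :
    ∃ n : ℕ, (T ^ n) w ≠ 0 ∧ T ((T ^ n) w) = 0 := by
  classical
  obtain ⟨n, hn⟩ : ∃ n, Nat.find hT = n + 1 := by
    refine Nat.exists_eq_succ_of_ne_zero fun h => hw ?_
    simpa [h] using Nat.find_spec hT
  refine ⟨n, Nat.find_min hT (by omega), ?_⟩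
  have := Nat.find_spec hT
  rwa [hn, pow_succ', Module.End.mul_apply] at this

/-- Operators satisfying the relations of the Chevalley generators of `sl2`. -/
structure Sl2Ops (E F H : Module.End ℂ W) : Prop where
  ef : ∀ w, E (F w) = F (E w) + H w
  he : ∀ w, H (E w) = E (H w) + (2 : ℂ) • E w
  hf : ∀ w, H (F w) = F (H w) - (2 : ℂ) • F w

namespace Sl2Ops

variable {E F H : Module.End ℂ W} (T : Sl2Ops E F H)
include T

lemma h_f_pow (j : ℕ) (w : W) : H ((F ^ j) w) = (F ^ j) (H w) - (2 * j : ℂ) • (F ^ j) w := by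
  induction j with
  | zero => simp
  | succ j ih =>
    rw [pow_succ', Module.End.mul_apply, Module.End.mul_apply, T.hf, ih, map_sub, map_smul]
    push_cast
    module

lemma e_f_pow {w : W} (hw : E w = 0) (j : ℕ) :
    E ((F ^ (j + 1)) w) = (j + 1 : ℂ) • (F ^ j) (H w - (j : ℂ) • w) := by
  induction j with
  | zero => simp [T.ef, hw]
  | succ j ih =>
    rw [pow_succ', Module.End.mul_apply, T.ef, ih, T.h_f_pow, map_smul, ← Module.End.mul_apply F,
      ← pow_succ', map_sub, map_sub, map_smul, map_smul]
    push_cast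
    module

/-- Let `F^j w` be the last nonzero power. Then `0 = E F^(j+1) w = (j + 1)(μ - j) F^j w`. -/
lemma weight_of_f_pow {w : W} (hw : w ≠ 0) (hE : E w = 0) (hF : ∃ n : ℕ, (F ^ n) w = 0) {μ : ℂ}
    (hH : H w = μ • w) : ∃ j : ℕ, μ = j ∧ (F ^ (j + 1)) w = 0 := by
  obtain ⟨j, hj, hj'⟩ := exists_pow_apply_ne_zero hw hF
  rw [← Module.End.mul_apply, ← pow_succ'] at hj'
  refine ⟨j, ?_, hj'⟩
  have h := T.e_f_pow hE j
  rw [hj', map_zero, hH, ← sub_smul, map_smul, smul_smul, eq_comm, smul_eq_zero,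
    or_iff_left hj, mul_eq_zero, or_iff_right (by exact_mod_cast j.succ_ne_zero)] at h
  exact sub_eq_zero.1 h

/-- A nonzero subspace stable under locally nilpotent `E` and `F` has a highest weight vector. -/
lemma exists_highest (P : Submodule ℂ W) (hPE : ∀ w ∈ P, E w ∈ P) (hPF : ∀ w ∈ P, F w ∈ P)
    (hE : ∀ w, ∃ n : ℕ, (E ^ n) w = 0) (hF : ∀ w, ∃ n : ℕ, (F ^ n) w = 0) {w : W} (hwP : w ∈ P)
    (hw : w ≠ 0) : ∃ v ∈ P, v ≠ 0 ∧ E v = 0 ∧ ∃ μ : ℂ, H v = μ • v := by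
  have hPH (w : W) (hw : w ∈ P) : H w ∈ P := by
    rw [show H w = E (F w) - F (E w) by rw [T.ef]; abel]
    exact sub_mem (hPE _ (hPF _ hw)) (hPF _ (hPE _ hw))
  -- Induction on the nilpotency order: if `E v = 0` and `F^(n+1) v = 0`, then `F^n (H v - n v) =
  -- 0`. Either `v` already has weight `n`, or `H v - n v` is a nonzero vector of smaller order,
  -- still killed by `E`.
  have key : ∀ (n : ℕ) (v : W), v ∈ P → v ≠ 0 → E v = 0 → (F ^ n) v = 0 →
      ∃ v ∈ P, v ≠ 0 ∧ E v = 0 ∧ ∃ μ : ℂ, H v = μ • v := by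
    intro n
    induction n with
    | zero => exact fun v _ hv _ h => (hv (by simpa using h)).elim
    | succ n ih =>
      intro v hvP hv hEv hFv
      by_cases hy : H v - (n : ℂ) • v = 0
      · exact ⟨v, hvP, hv, hEv, n, sub_eq_zero.1 hy⟩
      · refine ih _ (sub_mem (hPH v hvP) (P.smul_mem _ hvP)) hy ?_ ?_
        · have := T.he v
          rw [hEv, map_zero, smul_zero, add_zero] at this
          rw [map_sub, map_smul, hEv, ← this, smul_zero, sub_zero]
        · have h := T.e_f_pow hEv n
          rw [hFv, map_zero, eq_comm, smul_eq_zero,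
            or_iff_right (by exact_mod_cast n.succ_ne_zero)] at h
          exact h
  obtain ⟨n, hn, hn'⟩ := exists_pow_apply_ne_zero hw (hE w)
  have hPn (n : ℕ) : (E ^ n) w ∈ P := by
    induction n with
    | zero => simpa
    | succ n ih => rw [pow_succ', Module.End.mul_apply]; exact hPE _ ih
  obtain ⟨k, hk⟩ := hF ((E ^ n) w)
  exact key k _ (hPn n) hn hn' hk

end Sl2Ops

end Sl2

/-! ### Integrable affine modules: level and highest weight vectors -/

section Affine

/-- Local nilpotency of an operator. -/
def LocNilp {W : Type*} [AddCommGroup W] [Module ℂ W] (T : Module.End ℂ W) : Prop :=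
  ∀ w, ∃ n : ℕ, (T ^ n) w = 0

variable {W : Type*} [AddCommGroup W] [Module ℂ W]

/-- The vectors killed by the operators of index at least `M`. -/
def lowered (e f h : ℤ → Module.End ℂ W) (M : ℤ) : Submodule ℂ W where
  carrier := {w | ∀ p, M ≤ p → e p w = 0 ∧ f p w = 0 ∧ h p w = 0}
  zero_mem' := by simp
  add_mem' hv hw p hp := by simp [hv p hp, hw p hp]
  smul_mem' a w hw p hp := by simp [hw p hp]

namespace AffineSl2

variable {c : ℂ} {e f h : ℤ → Module.End ℂ W} (A : AffineSl2 c e f h)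
include A

lemma sl2Ops (m : ℤ) : Sl2Ops (e m) (f (-m)) (h 0 + (m * c : ℂ) • 1) where
  ef w := by
    rw [A.ef, add_neg_cancel, if_pos rfl]
    simp [add_assoc]
  he w := by
    simp only [LinearMap.add_apply, A.he, zero_add, LinearMap.smul_apply, Module.End.one_apply,
      map_add, map_smul]
    module
  hf w := by
    simp only [LinearMap.add_apply, A.hf, zero_add, LinearMap.smul_apply, Module.End.one_apply,
      map_add, map_smul]
    module

lemma sl2Ops_zero : Sl2Ops (e 0) (f 0) (h 0) := by
  simpa using A.sl2Ops 0

/-- The triple of the affine simple root: `e (-1)` plays the lowering operator and weights are `c`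
minus the horizontal weight. -/
lemma sl2Ops_affine : Sl2Ops (f 1) (e (-1)) (c • 1 - h 0) where
  ef w := by
    have := A.ef (-1) 1 w
    simp only [neg_add_cancel, if_true, Int.cast_neg, Int.cast_one] at this
    rw [this, LinearMap.sub_apply, LinearMap.smul_apply, Module.End.one_apply]
    module
  he w := by
    simp only [LinearMap.sub_apply, A.hf, zero_add, LinearMap.smul_apply, Module.End.one_apply,
      map_sub, map_smul]
    module
  hf w := by
    simp only [LinearMap.sub_apply, A.he, zero_add, LinearMap.smul_apply, Module.End.one_apply,
      map_sub, map_smul]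
    module

lemma level_nat [Nontrivial W] (hE : ∀ m, LocNilp (e m)) (hF : ∀ m, LocNilp (f m)) :
    ∃ k : ℕ, c = k := by
  obtain ⟨w, hw⟩ := exists_ne (0 : W)
  obtain ⟨v, -, hv, -, μ, hμ⟩ := A.sl2Ops_zero.exists_highest ⊤ (by simp) (by simp) (hE 0) (hF 0)
    (Submodule.mem_top (x := w)) hw
  obtain ⟨M, hM⟩ := eventually_atTop.1 (A.e_lower v)
  have key (m : ℤ) (hm : M ≤ m) : ∃ j : ℕ, μ + m * c = j := by
    obtain ⟨j, hj, -⟩ := (A.sl2Ops m).weight_of_f_pow hv (hM m hm) (hF (-m) v)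
      (μ := μ + m * c) (by simp [hμ, add_smul])
    exact ⟨j, hj⟩
  obtain ⟨a, ha⟩ := key M le_rfl
  obtain ⟨b, hb⟩ := key (M + 1) (by omega)
  have hc : c = ((b - a : ℤ) : ℂ) := by
    push_cast at hb ⊢
    rw [← ha, ← hb]
    ring
  suffices 0 ≤ (b - a : ℤ) by
    obtain ⟨k, hk⟩ := Int.eq_ofNat_of_zero_le this
    exact ⟨k, by rw [hc, hk]; simp⟩
  by_contra! hneg
  -- If the slope `b - a` is at most `-1`, then `a + 1` steps bring the natural number `a` below
  -- zero.
  obtain ⟨j, hj⟩ := key (M + (a + 1)) (by omega)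
  have h1 : ((a + (a + 1) * (b - a) : ℤ) : ℂ) = ((j : ℤ) : ℂ) := by
    push_cast at hj hc ⊢
    linear_combination hj - ha - (a + 1 : ℂ) * hc
  have h2 : (a + (a + 1) * (b - a) : ℤ) = j := by exact_mod_cast h1
  nlinarith

lemma e_mem_lowered {M q : ℤ} (hM : 1 ≤ M) (hq : 0 ≤ q) {w : W} (hw : w ∈ lowered e f h M) :
    e q w ∈ lowered e f h M := by
  intro p hp
  have h1 := hw p hp
  have h2 := hw (q + p) (by omega)
  have h3 := A.ef q p w
  rw [if_neg (by omega), h1.2.1, h2.2.2] at h3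
  refine ⟨by rw [A.ee, h1.1, map_zero], by simpa using h3.symm, ?_⟩
  rw [A.he, add_comm p q, h1.2.2, h2.1]
  simp

lemma f_mem_lowered {M q : ℤ} (hM : 1 ≤ M) (hq : 0 ≤ q) {w : W} (hw : w ∈ lowered e f h M) :
    f q w ∈ lowered e f h M := by
  intro p hp
  have h1 := hw p hp
  have h2 := hw (p + q) (by omega)
  refine ⟨?_, by rw [A.ff, h1.2.1, map_zero], ?_⟩
  · rw [A.ef, if_neg (by omega), h1.1, h2.2.2]
    simp
  · rw [A.hf, h1.2.2, h2.2.1]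
    simp

lemma h_mem_lowered {M q : ℤ} (hM : 1 ≤ M) (hq : 0 ≤ q) {w : W} (hw : w ∈ lowered e f h M) :
    h q w ∈ lowered e f h M := by
  rw [A.h_eq]
  exact sub_mem (A.e_mem_lowered hM hq (A.f_mem_lowered hM le_rfl hw))
    (A.f_mem_lowered hM le_rfl (A.e_mem_lowered hM hq hw))

lemma exists_mem_lowered (w : W) : ∃ M : ℕ, w ∈ lowered e f h (M + 1) := by
  obtain ⟨M, hM⟩ := eventually_atTop.1 ((A.e_lower w).and ((A.f_lower w).and (A.h_lower w)))
  exact ⟨M.toNat, fun p hp => hM p (by omega)⟩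

omit A in
lemma pow_mem {P : W → Prop} {T : Module.End ℂ W} (hT : ∀ w, P w → P (T w)) {w : W} (hw : P w)
    (n : ℕ) : P ((T ^ n) w) := by
  induction n with
  | zero => simpa
  | succ n ih => rw [pow_succ', Module.End.mul_apply]; exact hT _ ih

/-- The operators `f M`, `h M`, `e M` commute on `lowered (M + 1)`, so they can be killed one after
another. Only `h M` is not nilpotent by hypothesis; its nilpotency is deduced from that of `e M`,
after first passing to a vector killed by `f 0`. -/
lemma exists_lowered_of_succ {M : ℤ} (hM : 1 ≤ M) (hE : LocNilp (e M)) (hF : LocNilp (f M))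
    (hF0 : LocNilp (f 0)) {w : W} (hw : w ∈ lowered e f h (M + 1)) (hw0 : w ≠ 0) :
    ∃ v ∈ lowered e f h M, v ≠ 0 := by
  have hM' : 1 ≤ M + 1 := by omega
  -- on `lowered (M + 1)` the operators of index `M` commute
  have cfe {v : W} (hv : v ∈ lowered e f h (M + 1)) : f M (e M v) = e M (f M v) := by
    rw [A.ef, if_neg (by omega), (hv (M + M) (by omega)).2.2]
    simp
  have che {v : W} (hv : v ∈ lowered e f h (M + 1)) : h M (e M v) = e M (h M v) := by
    rw [A.he, (hv (M + M) (by omega)).1]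
    simp
  have chf {v : W} (hv : v ∈ lowered e f h (M + 1)) : h M (f M v) = f M (h M v) := by
    rw [A.hf, (hv (M + M) (by omega)).2.1]
    simp
  obtain ⟨n₁, h₁, h₁'⟩ := exists_pow_apply_ne_zero hw0 (hF w)
  have m₁ := pow_mem (P := (· ∈ lowered e f h (M + 1)))
    (fun v hv => A.f_mem_lowered hM' (by omega) hv) hw n₁ (T := f M)
  obtain ⟨n₂, h₂, h₂'⟩ := exists_pow_apply_ne_zero h₁ (hF0 _)
  have m₂ := pow_mem (P := fun v => v ∈ lowered e f h (M + 1) ∧ f M v = 0)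
    (fun v hv => ⟨A.f_mem_lowered hM' le_rfl hv.1, by rw [A.ff, hv.2, map_zero]⟩) ⟨m₁, h₁'⟩ n₂
    (T := f 0)
  generalize (f 0 ^ n₂) ((f M ^ n₁) w) = u at h₂ h₂' m₂
  -- stability of the conditions on `u`
  let Y (v : W) : Prop := (v ∈ lowered e f h (M + 1) ∧ f M v = 0) ∧ f 0 v = 0
  have hYh (v : W) (hv : Y v) : Y (h M v) := by
    refine ⟨⟨A.h_mem_lowered hM' (by omega) hv.1.1, by rw [← chf hv.1.1, hv.1.2, map_zero]⟩, ?_⟩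
    have := A.hf M 0 v
    rw [hv.2, map_zero, add_zero, hv.1.2, smul_zero, sub_zero] at this
    exact this.symm
  have hEm (n : ℕ) {v : W} (hv : v ∈ lowered e f h (M + 1)) : (e M ^ n) v ∈ lowered e f h (M + 1) :=
    pow_mem (P := (· ∈ lowered e f h (M + 1))) (fun v hv => A.e_mem_lowered hM' (by omega) hv) hv n
  have hEh (n : ℕ) {v : W} (hv : v ∈ lowered e f h (M + 1)) :
      h M ((e M ^ n) v) = (e M ^ n) (h M v) := by
    induction n with
    | zero => simp
    | succ n ih =>
      rw [pow_succ', Module.End.mul_apply, Module.End.mul_apply, che (hEm n hv), ih]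
  have hfe (n : ℕ) (v : W) (hv : Y v) :
      f 0 ((e M ^ (n + 1)) v) = -((n + 1 : ℂ) • (e M ^ n) (h M v)) := by
    have hs (y : W) : f 0 (e M y) = e M (f 0 y) - h M y := by
      rw [A.h_eq]; abel
    induction n with
    | zero => simp [hs, hv.2]
    | succ n ih =>
      rw [pow_succ', Module.End.mul_apply, hs, ih, hEh (n + 1) hv.1.1, map_neg, map_smul,
        ← Module.End.mul_apply (e M), ← pow_succ']
      push_cast
      module
  -- Applying `f 0` to a vanishing power of `e M` trades one factor `e M` for one `h M`, up to a
  -- nonzero scalar. Repeating this, `(e M)^a v = 0` implies `(h M)^a v = 0`.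
  have hdesc (a : ℕ) : ∀ (n : ℕ) (v : W), Y v → (e M ^ (n + a)) v = 0 →
      (e M ^ n) ((h M ^ a) v) = 0 := by
    induction a with
    | zero => exact fun n v _ h => by simpa using h
    | succ a ih =>
      intro n v hv hn
      rw [pow_succ, Module.End.mul_apply]
      refine ih n _ (hYh v hv) ?_
      have := hfe (n + a) v hv
      rw [add_assoc, hn, map_zero, eq_comm, neg_eq_zero, smul_eq_zero,
        or_iff_right (by exact_mod_cast (n + a).succ_ne_zero)] at this
      exact this
  obtain ⟨n₃, h₃⟩ := hE u
  have hYu : Y u := ⟨m₂, h₂'⟩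
  have hnil : (h M ^ n₃) u = 0 := by simpa using hdesc n₃ 0 u hYu (by simpa using h₃)
  obtain ⟨n₄, h₄, h₄'⟩ := exists_pow_apply_ne_zero h₂ ⟨n₃, hnil⟩
  have hY4 : Y ((h M ^ n₄) u) := pow_mem (P := Y) hYh hYu n₄
  generalize (h M ^ n₄) u = v at h₄ h₄' hY4
  obtain ⟨n₅, h₅, h₅'⟩ := exists_pow_apply_ne_zero h₄ (hE v)
  have m₅ := pow_mem (P := fun v => v ∈ lowered e f h (M + 1) ∧ f M v = 0 ∧ h M v = 0)
    (fun v hv => ⟨A.e_mem_lowered hM' (by omega) hv.1, by rw [cfe hv.1, hv.2.1, map_zero],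
      by rw [che hv.1, hv.2.2, map_zero]⟩) ⟨hY4.1.1, hY4.1.2, h₄'⟩ n₅ (T := e M)
  refine ⟨_, fun p hp => ?_, h₅⟩
  rcases hp.eq_or_lt with rfl | hp
  · exact ⟨h₅', m₅.2⟩
  · exact m₅.1 p (by omega)

lemma exists_mem_lowered_one [Nontrivial W] (hE : ∀ m, LocNilp (e m))
    (hF : ∀ m, LocNilp (f m)) : ∃ v ∈ lowered e f h 1, v ≠ 0 := by
  obtain ⟨w, hw⟩ := exists_ne (0 : W)
  obtain ⟨M, hM⟩ := A.exists_mem_lowered w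
  induction M generalizing w with
  | zero => exact ⟨w, by simpa using hM, hw⟩
  | succ M ih =>
    obtain ⟨v, hv, hv0⟩ := A.exists_lowered_of_succ (M := (M + 1 : ℕ)) (by simp) (hE _) (hF _)
      (hF 0) hM hw
    exact ih v hv0 (by simpa using hv)

/-- The horizontal triple makes the weight a natural number `j`; the affine triple makes `k - j`
one. -/
lemma exists_highest_lowered [Nontrivial W] (hE : ∀ m, LocNilp (e m))
    (hF : ∀ m, LocNilp (f m)) {k : ℕ} (hk : c = k) :
    ∃ v ∈ lowered e f h 1, v ≠ 0 ∧ ∃ j : ℕ, j ≤ k ∧ h 0 v = (j : ℂ) • v ∧ (f 0 ^ (j + 1)) v = 0 := by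
  obtain ⟨w, hw, hw0⟩ := A.exists_mem_lowered_one hE hF
  obtain ⟨v, hv, hv0, hev, μ, hμ⟩ := A.sl2Ops_zero.exists_highest (lowered e f h 1)
    (fun _ => A.e_mem_lowered le_rfl le_rfl) (fun _ => A.f_mem_lowered le_rfl le_rfl)
    (hE 0) (hF 0) hw hw0
  obtain ⟨j, rfl, hj'⟩ := A.sl2Ops_zero.weight_of_f_pow hv0 hev (hF 0 v) hμ
  obtain ⟨i, hi, -⟩ := A.sl2Ops_affine.weight_of_f_pow hv0 (hv 1 le_rfl).2.1 (hE _ v)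
    (μ := c - j) (by simp [hμ, sub_smul])
  refine ⟨v, hv, hv0, j, ?_, hμ, hj'⟩
  have : k = i + j := by
    rw [hk, sub_eq_iff_eq_add] at hi
    exact_mod_cast hi
  omega

end AffineSl2

end Affine

/-! ### Vanishing of `e(z)^(k+1)` on integrable modules of level `k` -/

section Affine

variable {W : Type*} [AddCommGroup W] [Module ℂ W]

namespace AffineSl2

variable {c : ℂ} {e f h : ℤ → Module.End ℂ W} (A : AffineSl2 c e f h)

/-- The vectors `w` such that `e(z)^r (f 0)^i w = 0` for all `i`. -/
def annihilated (r : ℕ) : Submodule ℂ W where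
  carrier := {w | ∀ (i : ℕ) (N : ℤ), A.R r N ((f 0 ^ i) w) = 0}
  zero_mem' := by simp
  add_mem' hv hw i N := by simp [hv i N, hw i N]
  smul_mem' a w hw i N := by simp [hw i N]

variable {A} in
lemma f_zero_mem_annihilated {r : ℕ} {w : W} (hw : w ∈ A.annihilated r) :
    f 0 w ∈ A.annihilated r := fun i N => by
  have h := hw (i + 1) N
  rwa [pow_succ, Module.End.mul_apply] at h

variable {A} in
lemma R_of_mem_annihilated {r : ℕ} {w : W} (hw : w ∈ A.annihilated r) (N : ℤ) :
    A.R r N w = 0 := by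
  simpa using hw 0 N

variable {A} in
-- By `f_R`, moving `f p` past `e(z)^(k+1)` creates only terms with `f 0`. Demanding annihilation on
-- all `(f 0)^i w` is what makes the condition stable.
lemma f_mem_annihilated {k : ℕ} (hk : c = k) (p : ℤ) {w : W} (hw : w ∈ A.annihilated (k + 1)) :
    f p w ∈ A.annihilated (k + 1) := by
  intro i N
  induction i generalizing w with
  | zero =>
    have h := A.f_R hk p N w
    rw [R_of_mem_annihilated hw, R_of_mem_annihilated hw,
      R_of_mem_annihilated (f_zero_mem_annihilated hw), map_zero, map_zero, sub_zero,
      add_zero] at h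
    exact h.symm
  | succ i ih =>
    rw [pow_succ, Module.End.mul_apply, A.ff]
    exact ih (f_zero_mem_annihilated hw)

variable {A} in
lemma h_mem_annihilated {k : ℕ} (hk : c = k) (p : ℤ) {w : W} (hw : w ∈ A.annihilated (k + 1)) :
    h p w ∈ A.annihilated (k + 1) := by
  intro i N
  induction i generalizing w with
  | zero =>
    have h := A.h_R p (k + 1) N w
    rw [R_of_mem_annihilated hw, R_of_mem_annihilated hw, map_zero, smul_zero, add_zero] at h
    exact h.symm
  | succ i ih =>
    have h := A.hf p 0 w
    rw [add_zero, eq_sub_iff_add_eq] at h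
    rw [pow_succ, Module.End.mul_apply, ← h, map_add, map_add, map_smul, map_smul,
      ih (f_zero_mem_annihilated hw), f_mem_annihilated hk p hw, smul_zero, add_zero]

variable {A} in
lemma e_mem_annihilated {k : ℕ} (hk : c = k) (p : ℤ) {w : W} (hw : w ∈ A.annihilated (k + 1)) :
    e p w ∈ A.annihilated (k + 1) := by
  intro i N
  induction i generalizing w with
  | zero =>
    have h := A.e_R p (k + 1) N w
    rw [R_of_mem_annihilated hw, map_zero] at h
    exact h.symm
  | succ i ih =>
    have h : f 0 (e p w) = e p (f 0 w) - h p w := by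
      rw [A.h_eq]
      abel
    rw [pow_succ, Module.End.mul_apply, h, map_sub, map_sub, ih (f_zero_mem_annihilated hw),
      h_mem_annihilated hk p hw, sub_zero]

include A in
/-- The induced operators on a quotient. -/
lemma quotient (K : Submodule ℂ W) (he : ∀ m, K ≤ K.comap (e m)) (hf : ∀ m, K ≤ K.comap (f m))
    (hh : ∀ m, K ≤ K.comap (h m)) :
    AffineSl2 c (fun m => K.mapQ K (e m) (he m)) (fun m => K.mapQ K (f m) (hf m))
      (fun m => K.mapQ K (h m) (hh m)) where
  ee m n := (K.mkQ_surjective.forall).2 fun w => congrArg K.mkQ (A.ee m n w)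
  ff m n := (K.mkQ_surjective.forall).2 fun w => congrArg K.mkQ (A.ff m n w)
  ef m n := (K.mkQ_surjective.forall).2 fun w => congrArg K.mkQ (A.ef m n w)
  he m n := (K.mkQ_surjective.forall).2 fun w => congrArg K.mkQ (A.he m n w)
  hf m n := (K.mkQ_surjective.forall).2 fun w => congrArg K.mkQ (A.hf m n w)
  e_lower := (K.mkQ_surjective.forall).2 fun w =>
    (A.e_lower w).mono fun m hm => by simp [hm]
  f_lower := (K.mkQ_surjective.forall).2 fun w =>
    (A.f_lower w).mono fun m hm => by simp [hm]

lemma mapQ_pow_mk {K : Submodule ℂ W} {T : Module.End ℂ W} (hT : K ≤ K.comap T) (n : ℕ) (w : W) :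
    (K.mapQ K T hT ^ n) (K.mkQ w) = K.mkQ ((T ^ n) w) := by
  induction n with
  | zero => simp
  | succ n ih => rw [pow_succ', Module.End.mul_apply, ih, pow_succ', Module.End.mul_apply]; rfl

lemma locNilp_mapQ {K : Submodule ℂ W} {T : Module.End ℂ W} (hT : K ≤ K.comap T)
    (hn : LocNilp T) : LocNilp (K.mapQ K T hT) :=
  (K.mkQ_surjective.forall).2 fun w => by
    obtain ⟨n, hn⟩ := hn w
    exact ⟨n, by rw [mapQ_pow_mk, hn, map_zero]⟩

/-- On an integrable module of level `k` one has `e(z)^(k+1) = 0`. -/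
theorem R_level_succ_eq_zero (hE : ∀ m, LocNilp (e m)) (hF : ∀ m, LocNilp (f m)) {k : ℕ}
    (hk : c = k) (N : ℤ) (w : W) : A.R (k + 1) N w = 0 := by
  set K := A.annihilated (k + 1) with hK
  suffices K = ⊤ from R_of_mem_annihilated (A := A) (by rw [← hK, this]; trivial) N
  by_contra hne
  have : Nontrivial (W ⧸ K) := Submodule.Quotient.nontrivial_iff.2 hne
  have hKe (m : ℤ) : K ≤ K.comap (e m) := fun _ => e_mem_annihilated hk m
  have hKf (m : ℤ) : K ≤ K.comap (f m) := fun _ => f_mem_annihilated hk m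
  have hKh (m : ℤ) : K ≤ K.comap (h m) := fun _ => h_mem_annihilated hk m
  obtain ⟨v', hv, hv0, j, hjk, hj, hj'⟩ := (A.quotient K hKe hKf hKh).exists_highest_lowered
    (fun m => locNilp_mapQ _ (hE m)) (fun m => locNilp_mapQ _ (hF m)) hk
  obtain ⟨v, rfl⟩ := K.mkQ_surjective v'
  have hv0 : v ∉ K := fun h => hv0 ((Submodule.Quotient.mk_eq_zero K).2 h)
  have hfj : (f 0 ^ (j + 1)) v ∈ K := by
    rw [mapQ_pow_mk] at hj'
    exact (Submodule.Quotient.mk_eq_zero K).1 hj'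
  have hf1 : f 1 v ∈ K := (Submodule.Quotient.mk_eq_zero K).1 (hv 1 le_rfl).2.1
  have hh0 : h 0 v - (j : ℂ) • v ∈ K := (Submodule.Quotient.eq K).1 hj
  have hpow (i : ℕ) {x : W} (hx : x ∈ K) : (f 0 ^ i) x ∈ K :=
    pow_mem (P := (· ∈ K)) (fun _ => f_zero_mem_annihilated) hx i
  have hlarge (i : ℕ) (hi : j < i) : (f 0 ^ i) v ∈ K := by
    obtain ⟨l, rfl⟩ := Nat.exists_eq_add_of_lt hi
    rw [show j + l + 1 = l + (j + 1) by ring, pow_add, Module.End.mul_apply]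
    exact hpow l hfj
  have hf1i (i : ℕ) : f 1 ((f 0 ^ i) v) = (f 0 ^ i) (f 1 v) := by
    induction i with
    | zero => simp
    | succ i ih => rw [pow_succ', Module.End.mul_apply, A.ff, ih, Module.End.mul_apply]
  -- One bound works for all `i`: only the finitely many `i ≤ j` matter, since `(f 0)^i v ∈ K`
  -- beyond them.
  have hbase : ∀ᶠ N in atTop, ∀ i, A.R (k + 1) N ((f 0 ^ i) v) = 0 := by
    have := (Finset.eventually_all (Finset.range (j + 1))
      (p := fun i N => A.R (k + 1) N ((f 0 ^ i) v) = 0) (l := atTop)).2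
      fun i _ => A.eventually_R_eq_zero (k + 1) ((f 0 ^ i) v)
    filter_upwards [this] with N hN i
    by_cases hi : i ∈ Finset.range (j + 1)
    · exact hN i hi
    · exact R_of_mem_annihilated (hlarge i (by rw [Finset.mem_range] at hi; omega)) N
  have hstep (N : ℤ) (hN : ∀ i, A.R (k + 1) (N + 1) ((f 0 ^ i) v) = 0) (i : ℕ) :
      A.R (k + 1) N ((f 0 ^ i) v) = 0 := by
    rcases lt_or_ge j i with hi | hi
    · exact R_of_mem_annihilated (hlarge i hi) N
    by_contra hy
    have h1 : f 1 (A.R (k + 1) N ((f 0 ^ i) v)) = 0 := by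
      rw [A.f_R hk, hN, ← Module.End.mul_apply (f 0), ← pow_succ', hN, map_zero, sub_zero,
        add_zero, hf1i, R_of_mem_annihilated (hpow i hf1)]
    have h2 : h 0 (A.R (k + 1) N ((f 0 ^ i) v))
        = (2 * (k + 1) + j - 2 * i : ℂ) • A.R (k + 1) N ((f 0 ^ i) v) := by
      have h3 := R_of_mem_annihilated (hpow i hh0) N
      rw [map_sub, map_sub, sub_eq_zero, map_smul, map_smul] at h3
      rw [A.h_R, A.sl2Ops_zero.h_f_pow, map_sub, h3, map_smul, add_zero]
      push_cast
      module
    -- A nonzero value would have affine weight `k - (2(k + 1) + j - 2i) = l ≥ 0`, hence `2i ≥ k + j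
    -- + 2`, against `i ≤ j ≤ k`.
    obtain ⟨l, hl, -⟩ := A.sl2Ops_affine.weight_of_f_pow hy h1 (hE (-1) _)
      (μ := c - (2 * (k + 1) + j - 2 * i)) (by
        rw [LinearMap.sub_apply, LinearMap.smul_apply, Module.End.one_apply, h2, ← sub_smul])
    rw [hk] at hl
    have h4 : ((2 * i : ℕ) : ℂ) = ((l + k + 2 + j : ℕ) : ℂ) := by
      push_cast
      linear_combination hl
    have h5 : 2 * i = l + k + 2 + j := by exact_mod_cast h4
    omega
  obtain ⟨B, hB⟩ := eventually_atTop.1 hbase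
  refine hv0 fun i N => ?_
  rcases le_total B N with hN | hN
  · exact hB N hN i
  · induction N, hN using Int.leInductionDown generalizing i with
    | base => exact hB B le_rfl i
    | pred N hN ih => exact hstep (N - 1) (by simpa using ih) i

end AffineSl2

end Affine

/-! ### From a vanishing power of a field to local nilpotency -/

section Nilpotency

variable {W : Type*} [AddCommGroup W] [Module ℂ W] {X : ℤ → Module.End ℂ W}

open scoped IsMulCommutative in
/-- If some power of a commuting field is zero then its coefficients are locally nilpotent. -/
theorem IsCommutingField.locNilp_of_seriesPowEqZero (hX : IsCommutingField X) {k : ℕ}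
    (hk : SeriesPowEqZero X k) (m : ℤ) : LocNilp (X m) := by
  intro w
  let B := Algebra.adjoin ℂ (Set.range X)
  have : IsMulCommutative B := Algebra.isMulCommutative_adjoin ℂ (by
    rintro _ ⟨m, rfl⟩ _ ⟨n, rfl⟩
    exact hX.comm m n)
  let x (m : ℤ) : B := ⟨X m, Algebra.subset_adjoin ⟨m, rfl⟩⟩
  -- Nilpotency of `X m` on `w` means membership of `x m` in the radical of the annihilator of `w`.
  -- Radicals are ideals, so sums of products can be handled.
  let I : Ideal B :=
    { carrier := {b | b.1 w = 0}
      zero_mem' := rfl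
      add_mem' := fun {a b} ha hb => by
        change (a.1 + b.1) w = 0
        rw [LinearMap.add_apply, ha, hb, add_zero]
      smul_mem' := fun a b hb => by
        change (a.1 * b.1) w = 0
        rw [Module.End.mul_apply, hb, map_zero] }
  suffices x m ∈ I.radical by
    obtain ⟨n, hn⟩ := this
    exact ⟨n, hn⟩
  have hval {r : ℕ} (l : Fin r → ℤ) :
      ((List.ofFn fun i => x (l i)).prod : B).1 = (List.ofFn fun i => X (l i)).prod := by
    rw [← Subalgebra.coe_val, map_list_prod, List.map_ofFn]
    rfl
  obtain ⟨M, -, hM⟩ := hX.exists_bound w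
  have key (n : ℕ) : ∀ m, M < m + n → x m ∈ I.radical := by
    induction n with
    | zero => exact fun m hm => Ideal.le_radical (hM m (by simpa using hm))
    | succ n ih =>
      intro m hm
      classical
      have ih' (j : ℤ) (hj : m < j) : x j ∈ I.radical := ih j (by push_cast at hm; omega)
      refine I.radical_isRadical ⟨k, ?_⟩
      have hfin := hX.finite_ofFn_prod_ne_zero k (k * m) w
      -- The constant tuple is inserted by hand, as its product may already kill `w` and so be
      -- missing from the support.
      let T : Finset (Fin k → ℤ) := insert (fun _ => m) hfin.toFinset
      have hT : ∀ l ∈ T, ∑ i, l i = k * m := by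
        intro l hl
        rcases Finset.mem_insert.1 hl with rfl | hl
        · simp
        · exact (hfin.mem_toFinset.1 hl).1
      have hsum : (∑ l ∈ T, (List.ofFn fun i => x (l i)).prod : B) ∈ I := by
        change (∑ l ∈ T, (List.ofFn fun i => x (l i)).prod : B).1 w = 0
        rw [← Subalgebra.coe_val, map_sum, LinearMap.sum_apply]
        simp only [Subalgebra.coe_val, hval]
        rw [← (hk (k * m) w).2]
        symm
        refine finsum_mem_eq_sum_of_inter_support_eq _ ?_
        ext l
        constructor
        · exact fun h => ⟨Finset.mem_insert_of_mem (hfin.mem_toFinset.2 h), h.2⟩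
        · exact fun h => ⟨hT l h.1, h.2⟩
      have hm_mem : (fun _ => m) ∈ T := Finset.mem_insert_self _ _
      rw [← Finset.add_sum_erase T _ hm_mem, List.ofFn_const, List.prod_replicate] at hsum
      refine (I.radical.add_mem_iff_left (Ideal.sum_mem _ fun l hl => ?_)).1
        (Ideal.le_radical hsum)
      obtain ⟨hne, hl⟩ := Finset.mem_erase.1 hl
      -- The average of the indices is `m`, so a nonconstant tuple has an index above `m`.
      obtain ⟨i, hi⟩ : ∃ i, m < l i := by
        by_contra! hle
        refine hne (funext fun i => ?_)
        refine (Finset.sum_eq_sum_iff_of_le (f := l) (g := fun _ => m) fun i _ => hle i).1 ?_ i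
          (Finset.mem_univ i)
        rw [hT l hl]
        simp
      rw [List.prod_ofFn]
      exact Ideal.mem_of_dvd _ (Finset.dvd_prod_of_mem _ (Finset.mem_univ i)) (ih' _ hi)
  exact key (M + 1 - m).toNat m (by omega)

end Nilpotency

/-! ### Rows of the baby TKK algebra satisfy affine `sl₂` relations -/

section Brackets

variable {A : Type*} [NonUnitalNonAssocCommRing A] [Module ℂ A] [IsScalarTower ℂ A A]
  [SMulCommClass ℂ A A] [IsCommJordan A]

omit [IsScalarTower ℂ A A] [SMulCommClass ℂ A A] [IsCommJordan A] in
lemma TKK.tensor_fst (X : sl2) (a : A) : (TKK.tensor X a).1 = X ⊗ₜ[ℂ] a := rfl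

omit [IsScalarTower ℂ A A] [SMulCommClass ℂ A A] [IsCommJordan A] in
lemma TKK.tensor_snd (X : sl2) (a : A) : (TKK.tensor X a).2 = 0 := rfl

omit [IsScalarTower ℂ A A] [SMulCommClass ℂ A A] [IsCommJordan A] in
lemma TKK.angle_fst (a b : A) : (TKK.angle a b).1 = 0 := rfl

omit [IsScalarTower ℂ A A] [SMulCommClass ℂ A A] [IsCommJordan A] in
lemma TKK.angle_snd (a b : A) : (TKK.angle a b).2 = BabyTKK.angle a b := rfl

lemma TKK.tensor_lie_tensor (X Y : sl2) (a b : A) :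
    ⁅TKK.tensor X a, TKK.tensor Y b⁆
      = TKK.tensor ⁅X, Y⁆ (a * b) + (2 * trForm X Y) • TKK.angle a b := by
  refine Prod.ext ?_ ?_
  · simp [TKK.bracket_fst, TKK.add_fst, TKK.smul_fst, TKK.tensor_fst, TKK.tensor_snd, TKK.angle_fst,
       tensorBracket_tmul]
  · simp [TKK.bracket_snd, TKK.add_snd, TKK.smul_snd, TKK.tensor_fst, TKK.tensor_snd, TKK.angle_snd,
       tensorPairing_tmul]

lemma TKK.angle_lie_tensor (a b c : A) (X : sl2) :
    ⁅TKK.angle a b, TKK.tensor X c⁆ = TKK.tensor X (a * (b * c) - b * (a * c)) := by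
  refine Prod.ext ?_ ?_
  · simp [TKK.bracket_fst, TKK.tensor_fst, TKK.tensor_snd, TKK.angle_fst, TKK.angle_snd,
      innerAction_tmul, der_angle]
  · simp [TKK.bracket_snd, TKK.tensor_snd, TKK.angle_fst]

omit [IsScalarTower ℂ A A] [SMulCommClass ℂ A A] [IsCommJordan A] in
lemma TKK.tensor_zero (X : sl2) : TKK.tensor X (0 : A) = 0 := by
  simp only [TKK.tensor, TensorProduct.tmul_zero]
  rfl

omit [IsScalarTower ℂ A A] [SMulCommClass ℂ A A] [IsCommJordan A] in
lemma TKK.tensor_smul_left (r : ℂ) (X : sl2) (a : A) :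
    TKK.tensor (r • X) a = r • TKK.tensor X a := by
  refine Prod.ext ?_ ?_
  · exact (TensorProduct.smul_tmul' r X a).symm
  · exact (smul_zero r).symm

end Brackets

lemma mem_S {m n : ℤ} (h : Even m ∨ Even n) : (m, n) ∈ S := by
  rw [J.mem_S_iff]
  simpa [J.par] using h

/-- `⟨x^(m,0), x^(p,0)⟩` is `m C₁` if `m + p = 0`, and `0` otherwise. -/
lemma angle_x_row_zero (m p : ℤ) :
    angle (J.x (m, 0)) (J.x (p, 0))
      = (if m + p = 0 then (m : ℂ) else 0) • angle (J.x (1, 0)) (J.x (-1, 0)) := by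
  have mul (a b : ℤ) : J.x (a, 0) * J.x (b, 0) = J.x (a + b, 0) := by
    rw [J.x_mul_x (mem_S (by simp)) (mem_S (by simp))]
    simp
  have cyc (a b c : ℤ) : angle (J.x (a + b, 0)) (J.x (c, 0))
      + angle (J.x (b + c, 0)) (J.x (a, 0)) + angle (J.x (c + a, 0)) (J.x (b, 0)) = 0 := by
    simpa only [mul] using angle_cyclic (J.x (a, 0)) (J.x (b, 0)) (J.x (c, 0))
  have hz (s : ℤ) : angle (J.x (s, 0)) (J.x (0, 0)) = 0 := by
    have h := cyc s 0 0
    rw [add_zero, zero_add, zero_add, angle_skew (J.x (0, 0))] at h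
    simpa using h
  -- At fixed total degree `s`, the cyclic relation together with skew-symmetry says that the
  -- pairing is additive in the first exponent.
  let ψ (s : ℤ) : ℤ →+ InnerSpace J := AddMonoidHom.mk'
    (fun a => angle (J.x (a, 0)) (J.x (s - a, 0))) fun a b => by
      have h := cyc a b (s - (a + b))
      rw [show b + (s - (a + b)) = s - a by ring, show s - (a + b) + a = s - b by ring,
        angle_skew (J.x (s - a, 0)), angle_skew (J.x (s - b, 0))] at h
      rw [← sub_eq_zero, ← h]
      abel
  have hψ (s a : ℤ) : angle (J.x (a, 0)) (J.x (s - a, 0))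
      = (a : ℂ) • angle (J.x (1, 0)) (J.x (s - 1, 0)) := by
    have h := map_zsmul (ψ s) a 1
    rw [smul_eq_mul, mul_one] at h
    rw [Int.cast_smul_eq_zsmul]
    exact h
  have h := hψ (m + p) m
  rw [add_sub_cancel_left] at h
  rw [h]
  by_cases hs : m + p = 0
  · rw [if_pos hs, hs, zero_sub]
  -- For `s = m + p ≠ 0`, exponent `s` gives `s ⟨x^(1,0), x^(s-1,0)⟩ = ⟨x^(s,0), x^(0,0)⟩ = 0`.
  · have h0 := hψ (m + p) (m + p)
    rw [sub_self, hz, eq_comm, smul_eq_zero, or_iff_right (by exact_mod_cast hs)] at h0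
    rw [if_neg hs, h0, smul_zero, zero_smul]

/-- The cyclic relation for `x^(m,a)`, `x^(p,0)`, `x^(0,-a)` reduces to row zero. -/
lemma angle_x_row {a m p : ℤ} (hm : Even m ∨ Even a) :
    angle (J.x (m, a)) (J.x (p, -a)) = angle (J.x (m + p, a)) (J.x (0, -a))
      + (if m + p = 0 then (m : ℂ) else 0) • angle (J.x (1, 0)) (J.x (-1, 0)) := by
  have h := angle_cyclic (J.x (m, a)) (J.x (p, 0)) (J.x (0, -a))
  rw [J.x_mul_x (mem_S hm) (mem_S (by simp)), J.x_mul_x (mem_S (by simp)) (mem_S (by simp)),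
    J.x_mul_x (mem_S (by simp)) (mem_S hm)] at h
  simp only [Prod.mk_add_mk, add_zero, zero_add, neg_add_cancel] at h
  rw [angle_skew (J.x (p, -a)), angle_x_row_zero] at h
  rw [← sub_eq_zero, ← neg_eq_zero, ← h]
  abel

/-- A pair of elements of `sl2` which behaves as `(x₊, x₋)`. -/
structure IsChevalleyPair (X Y : sl2) : Prop where
  lie_left : ⁅⁅X, Y⁆, X⁆ = (2 : ℂ) • X
  lie_right : ⁅⁅X, Y⁆, Y⁆ = (-2 : ℂ) • Y
  tr : trForm X Y = 1
  tr_left : trForm X X = 0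
  tr_right : trForm Y Y = 0

namespace IsChevalleyPair

lemma symm {X Y : sl2} (P : IsChevalleyPair X Y) : IsChevalleyPair Y X where
  lie_left := by rw [← lie_skew Y X, neg_lie, P.lie_right, neg_smul, neg_neg]
  lie_right := by rw [← lie_skew Y X, neg_lie, P.lie_left, neg_smul]
  tr := by rw [trForm_comm, P.tr]
  tr_left := P.tr_right
  tr_right := P.tr_left

lemma of_tr {X Y : sl2} (tr : trForm X Y = 1) (tr_left : trForm X X = 0)
    (tr_right : trForm Y Y = 0) : IsChevalleyPair X Y where
  lie_left := by rw [sl2_lie_lie, tr_left, trForm_comm, tr]; simp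
  lie_right := by rw [sl2_lie_lie, tr_right, tr]; simp
  tr := tr
  tr_left := tr_left
  tr_right := tr_right

lemma ePlus_eMinus : IsChevalleyPair ePlus eMinus := by
  have hp : ePlus.val = Matrix.single 0 1 1 := rfl
  have hm : eMinus.val = Matrix.single 1 0 1 := rfl
  refine of_tr ?_ ?_ ?_ <;>
    simp [trForm_apply, hp, hm]

end IsChevalleyPair

/-- Up to the central term, the bracket depends only on `m + p`; the representative with `p = 0`
serves as the Cartan mode of the row. -/
lemma tensor_lie_x_row {X Y : sl2} (P : IsChevalleyPair X Y) {a m p : ℤ} (hm : Even m ∨ Even a)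
    (hp : Even p ∨ Even a) :
    (⁅TKK.tensor X (J.x (m, a)), TKK.tensor Y (J.x (p, -a))⁆ : G)
      = ⁅TKK.tensor X (J.x (m + p, a)), TKK.tensor Y (J.x (0, -a))⁆
        + (if m + p = 0 then (m : ℂ) else 0) • ((2 : ℂ) • C₁ 0 0) := by
  have hmp : Even (m + p) ∨ Even a := by
    rcases hm with hm | hm
    · exact hp.imp_left hm.add
    · exact Or.inr hm
  have hT : (TKK.angle (J.x (m, a)) (J.x (p, -a)) : G) = TKK.angle (J.x (m + p, a)) (J.x (0, -a))
      + (if m + p = 0 then (m : ℂ) else 0) • C₁ 0 0 := by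
    have hC : C₁ 0 0 = TKK.angle (J.x (1, 0)) (J.x (-1, 0)) := by
      rw [C₁, if_pos ⟨Even.zero, Even.zero⟩, zero_sub]
    rw [hC]
    refine Prod.ext ?_ (angle_x_row hm)
    rw [TKK.add_fst, TKK.smul_fst, TKK.angle_fst, TKK.angle_fst, TKK.angle_fst, smul_zero,
      add_zero]
  rw [TKK.tensor_lie_tensor, TKK.tensor_lie_tensor, P.tr, hT,
    J.x_mul_x (mem_S hm) (mem_S (by simpa using hp)),
    J.x_mul_x (mem_S hmp) (mem_S (by simp))]
  simp only [Prod.mk_add_mk, add_zero, mul_one, smul_add]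
  rw [smul_comm (2 : ℂ), add_assoc]

/-- Under the parity hypotheses all the exponents involved lie in `S`, so the products associate as
in a group algebra and the inner derivation contributes nothing. -/
lemma h_lie_e_row {X Y : sl2} (P : IsChevalleyPair X Y) {a m p : ℤ} (hm : Even m ∨ Even a)
    (hp : Even p ∨ Even a) :
    (⁅⁅TKK.tensor X (J.x (m, a)), TKK.tensor Y (J.x (0, -a))⁆, TKK.tensor X (J.x (p, a))⁆ : G)
      = (2 : ℂ) • TKK.tensor X (J.x (m + p, a)) := by
  have hmp : Even (m + p) ∨ Even (a + a) := by simp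
  have htr : trForm ⁅X, Y⁆ X = 0 := by
    rw [trForm_comm, ← trForm_lie, lie_self]
    simp
  rw [TKK.tensor_lie_tensor, add_lie, smul_lie, TKK.tensor_lie_tensor, TKK.angle_lie_tensor, htr,
    P.lie_left, J.x_mul_x (mem_S hm) (mem_S (by simp)),
    J.x_mul_x (mem_S (by simp)) (mem_S hp), J.x_mul_x (mem_S hm) (mem_S hp)]
  simp only [Prod.mk_add_mk, add_zero, zero_add, add_neg_cancel]
  rw [J.x_mul_x (mem_S (by simp)) (mem_S hp), J.x_mul_x (mem_S hm) (mem_S (by simp)),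
    J.x_mul_x (mem_S (by simp)) (mem_S hmp)]
  simp [TKK.tensor_zero, TKK.tensor_smul_left]

lemma h_lie_f_row {X Y : sl2} (P : IsChevalleyPair X Y) {a m p : ℤ} (hm : Even m ∨ Even a)
    (hp : Even p ∨ Even a) :
    (⁅⁅TKK.tensor X (J.x (m, a)), TKK.tensor Y (J.x (0, -a))⁆, TKK.tensor Y (J.x (p, -a))⁆ : G)
      = (-2 : ℂ) • TKK.tensor Y (J.x (m + p, -a)) := by
  have hp' : Even p ∨ Even (-a) := by simpa using hp
  have hmp : Even p ∨ Even (-a + -a) := by simp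
  have hpa : J.x (0, -a) * J.x (p, -a) = J.x (p, -a + -a) := by
    rw [J.x_mul_x (mem_S (by simp)) (mem_S hp'), Prod.mk_add_mk, zero_add]
  have htr : trForm ⁅X, Y⁆ Y = 0 := by
    rw [trForm_lie, lie_self]
    simp
  rw [TKK.tensor_lie_tensor, add_lie, smul_lie, TKK.tensor_lie_tensor, TKK.angle_lie_tensor, htr,
    P.lie_right, J.x_mul_x (mem_S hm) (mem_S (by simp)), hpa, J.x_mul_x (mem_S hm) (mem_S hp')]
  simp only [Prod.mk_add_mk, add_zero, add_neg_cancel]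
  rw [J.x_mul_x (mem_S (by simp)) (mem_S hp'), J.x_mul_x (mem_S hm) (mem_S hmp),
    J.x_mul_x (mem_S (by simp)) (mem_S (by simp))]
  simp only [Prod.mk_add_mk, add_zero, zero_add, sub_self, TKK.tensor_zero, mul_zero, zero_smul,
    smul_zero, add_neg_cancel_left, TKK.tensor_smul_left]

lemma tensor_lie_same {X : sl2} (hX : trForm X X = 0) (a b : J) :
    (⁅TKK.tensor X a, TKK.tensor X b⁆ : G) = 0 := by
  rw [TKK.tensor_lie_tensor, hX, lie_self]
  simp only [TKK.tensor, TensorProduct.zero_tmul, mul_zero, zero_smul]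
  rfl

/-! ### Row operators on modules -/

section Modules

variable {W : Type*} [AddCommGroup W] [Module ℂ W] [LieRingModule G W] [LieModule ℂ G W]

variable (W) in
/-- For each `n` and `w`, the element `X ⊗ x^(m,n)` kills `w` for large `m`. -/
def IsLowered (X : sl2) : Prop :=
  ∀ (w : W) (n : ℤ), ∀ᶠ m : ℤ in atTop, ⁅(TKK.tensor X (J.x (m, n)) : G), w⁆ = 0

variable (W) in
/-- The operators of the elements `X ⊗ x^(d m, a)`, `m ∈ ℤ`. -/
def row (X : sl2) (d a : ℤ) : ℤ → Module.End ℂ W :=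
  fun m => act W (TKK.tensor X (J.x (d * m, a)))

lemma IsLowered.row {X : sl2} (hX : IsLowered W X) {d : ℤ} (hd : 1 ≤ d) (a : ℤ) (w : W) :
    ∀ᶠ m in atTop, row W X d a m w = 0 := by
  have ht : Tendsto (fun m : ℤ => d * m) atTop atTop := by
    refine tendsto_atTop_mono' _ ?_ tendsto_id
    filter_upwards [eventually_ge_atTop 0] with m hm
    simp only [id]
    nlinarith
  exact ht.eventually (hX w a)

lemma isCommutingField_row {X : sl2} (htr : trForm X X = 0) (hX : IsLowered W X) {d : ℤ}
    (hd : 1 ≤ d) (a : ℤ) : IsCommutingField (row W X d a) where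
  comm m n := by
    refine LinearMap.ext fun w => ?_
    have h := leibniz_lie (TKK.tensor X (J.x (d * m, a)) : G) (TKK.tensor X (J.x (d * n, a))) w
    rw [tensor_lie_same htr, zero_lie, zero_add] at h
    exact h
  lower := hX.row hd a

/-- The central term at index `d m` is `d m ℓ = m (d ℓ)`, so sampling every `d`-th mode multiplies
the level by `d`. -/
lemma affineSl2_row {X Y : sl2} (P : IsChevalleyPair X Y) (hX : IsLowered W X)
    (hY : IsLowered W Y) {ℓ : ℂ} (hlevel : IsOfLevel W ℓ) {d a : ℤ} (hd : 1 ≤ d)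
    (hda : Even d ∨ Even a) :
    AffineSl2 (d * ℓ) (row W X d a) (row W Y d (-a))
      (fun q => act W ⁅TKK.tensor X (J.x (d * q, a)), TKK.tensor Y (J.x (0, -a))⁆) := by
  have hpar (m : ℤ) : Even (d * m) ∨ Even a := hda.imp_left fun h => h.mul_right m
  refine ⟨fun m n => LinearMap.congr_fun ((isCommutingField_row P.tr_left hX hd a).comm m n),
    fun m n => LinearMap.congr_fun ((isCommutingField_row P.tr_right hY hd (-a)).comm m n),
    fun m n w => ?_, fun m n w => ?_, fun m n w => ?_, hX.row hd a, hY.row hd (-a)⟩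
  · have h := leibniz_lie (TKK.tensor X (J.x (d * m, a)) : G) (TKK.tensor Y (J.x (d * n, -a))) w
    rw [tensor_lie_x_row P (hpar m) (hpar n), add_lie, smul_lie, hlevel, smul_smul,
      ← mul_add] at h
    refine h.trans ?_
    rw [add_comm, ← add_assoc]
    congr 2
    have hd0 : d ≠ 0 := by omega
    simp only [mul_eq_zero, hd0, false_or]
    split_ifs
    · push_cast
      ring
    · simp
  · have h := leibniz_lie (⁅TKK.tensor X (J.x (d * m, a)), TKK.tensor Y (J.x (0, -a))⁆ : G)
      (TKK.tensor X (J.x (d * n, a))) w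
    rw [h_lie_e_row P (hpar m) (hpar n), smul_lie, ← mul_add, add_comm] at h
    exact h
  · have h := leibniz_lie (⁅TKK.tensor X (J.x (d * m, a)), TKK.tensor Y (J.x (0, -a))⁆ : G)
      (TKK.tensor Y (J.x (d * n, -a))) w
    rw [h_lie_f_row P (hpar m) (hpar n), smul_lie, ← mul_add, add_comm, neg_smul,
      ← sub_eq_add_neg] at h
    exact h

variable (W) in
/-- Local nilpotency of the elements `X ⊗ x^ρ`, `ρ ∈ S`. -/
def IsLocNilp (X : sl2) : Prop :=
  ∀ m n : ℤ, (m, n) ∈ S → LocNilp (act W (TKK.tensor X (J.x (m, n))))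

lemma IsLocNilp.row {X : sl2} (hX : IsLocNilp W X) {d a : ℤ} (hda : Even d ∨ Even a) (m : ℤ) :
    LocNilp (row W X d a m) :=
  hX _ _ (mem_S (hda.imp_left fun h => h.mul_right m))

lemma level_nat_of_isLocNilp [Nontrivial W] {X Y : sl2} (P : IsChevalleyPair X Y)
    (hX : IsLowered W X) (hY : IsLowered W Y) {ℓ : ℂ} (hlevel : IsOfLevel W ℓ)
    (nX : IsLocNilp W X) (nY : IsLocNilp W Y) : ∃ k : ℕ, ℓ = k := by
  have h0 : Even (1 : ℤ) ∨ Even (0 : ℤ) := by simp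
  simpa using (affineSl2_row P hX hY hlevel le_rfl h0).level_nat (nX.row h0)
    (nY.row (by simp))

lemma row_seriesPowEqZero {X Y : sl2} (P : IsChevalleyPair X Y)
    (hX : IsLowered W X) (hY : IsLowered W Y) {ℓ : ℂ} (hlevel : IsOfLevel W ℓ)
    (nX : IsLocNilp W X) (nY : IsLocNilp W Y) {d a : ℤ} (hd : 1 ≤ d) (hda : Even d ∨ Even a)
    {k : ℕ} (hk : d * ℓ = k) : SeriesPowEqZero (row W X d a) (k + 1) := by
  have A := affineSl2_row P hX hY hlevel hd hda
  rw [A.isCommutingField.seriesPowEqZero_iff]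
  exact A.R_level_succ_eq_zero (nX.row hda) (nY.row (by simpa using hda)) hk

end Modules

/-- If the coefficients of odd index vanish then `X(z)` may be regarded as a series in `z^2`. -/
lemma seriesPowEqZero_of_even {W : Type*} [AddCommGroup W] [Module ℂ W] {X : ℤ → Module.End ℂ W}
    (hX : IsCommutingField X) (hodd : ∀ m, ¬ Even m → X m = 0) {r : ℕ}
    (h : SeriesPowEqZero (fun m => X (2 * m)) r) : SeriesPowEqZero X r := by
  refine (hX.seriesPowEqZero_iff r).2 fun N w => ?_
  have heven (m : Fin r → ℤ) (hm : (List.ofFn fun i => X (m i)).prod w ≠ 0) (i : Fin r) :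
      Even (m i) := by
    by_contra hi
    exact hm (hX.ofFn_prod_eq_zero m w i (by rw [hodd _ hi, LinearMap.zero_apply]))
  have hinj : Function.Injective fun (m : Fin r → ℤ) (i : Fin r) => 2 * m i := fun m n hmn =>
    funext fun i => by simpa using congrFun hmn i
  by_cases hN : Even N
  · obtain ⟨N', rfl⟩ := hN.two_dvd
    rw [← (h N' w).2, powCoeff, ← finsum_mem_image (f := fun m : Fin r → ℤ =>
      (List.ofFn fun i => X (m i)).prod w) hinj.injOn]
    refine finsum_mem_inter_support_eq' _ _ _ fun m hm => ⟨fun hsum => ?_, ?_⟩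
    · choose n hn using fun i => (heven m hm i).two_dvd
      refine ⟨n, ?_, (funext hn).symm⟩
      have hsum' : ∑ i, m i = 2 * N' := hsum
      simp only [hn, ← Finset.mul_sum] at hsum'
      exact mul_left_cancel₀ two_ne_zero hsum'
    · rintro ⟨n, hn, rfl⟩
      have hn' : ∑ i, n i = N' := hn
      simp [← Finset.mul_sum, hn']
  · refine finsum_mem_eq_zero_of_forall_eq_zero fun m hm => ?_
    by_contra hne
    have hm' : ∑ i, m i = N := hm
    exact hN (hm' ▸ Finset.even_sum _ fun i _ => heven m hne i)

section Modules

variable {W : Type*} [AddCommGroup W] [Module ℂ W] [LieRingModule G W] [LieModule ℂ G W]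

/-- An odd row meets `S` only in even `m`, so it is the affine algebra with step `2` and level `2k`,
written in the variable `z^2`. -/
lemma row_odd_seriesPowEqZero {X Y : sl2} (P : IsChevalleyPair X Y)
    (hX : IsLowered W X) (hY : IsLowered W Y) {ℓ : ℂ} (hlevel : IsOfLevel W ℓ)
    (nX : IsLocNilp W X) (nY : IsLocNilp W Y) {k : ℕ} (hk : ℓ = k) {a : ℤ} (ha : Odd a) :
    SeriesPowEqZero (row W X 1 a) (2 * k + 1) := by
  refine seriesPowEqZero_of_even (isCommutingField_row P.tr_left hX le_rfl a) (fun m hm => ?_) ?_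
  · have h : (1 * m, a) ∉ S := by
      rw [J.mem_S_iff]
      simpa [J.par] using ⟨Int.not_even_iff_odd.1 hm, ha⟩
    rw [row, J.x_of_notMem h, TKK.tensor_zero]
    exact map_zero (LieModule.toEnd ℂ G W)
  · simp only [row, one_mul]
    exact row_seriesPowEqZero P hX hY hlevel nX nY (d := 2) (a := a) (by norm_num)
      (Or.inl even_two) (k := 2 * k) (by simp [hk])

lemma isLocNilp_of_row {X : sl2} (htr : trForm X X = 0) (hX : IsLowered W X) {r s : ℕ}
    (hev : ∀ n : ℤ, SeriesPowEqZero (row W X 1 (2 * n)) r)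
    (hod : ∀ n : ℤ, SeriesPowEqZero (row W X 1 (2 * n + 1)) s) : IsLocNilp W X := by
  intro m n _
  rw [← one_mul m]
  obtain ⟨n, rfl | rfl⟩ := Int.even_or_odd' n
  · exact (isCommutingField_row htr hX le_rfl _).locNilp_of_seriesPowEqZero (hev n) m
  · exact (isCommutingField_row htr hX le_rfl _).locNilp_of_seriesPowEqZero (hod n) m

end Modules

end BabyTKK

end

theorem proposition5p3 (W : Type*) [AddCommGroup W] [Module ℂ W]
    [LieRingModule BabyTKK.G W] [LieModule ℂ BabyTKK.G W] [Nontrivial W]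
    (ℓ : ℂ) (hres : BabyTKK.IsRestricted W) (hlevel : BabyTKK.IsOfLevel W ℓ) :
    BabyTKK.IsIntegrable W ↔
      ∃ k : ℕ, ℓ = (k : ℂ) ∧ ∀ n : ℤ,
        BabyTKK.SeriesPowEqZero (BabyTKK.seriesPlus W (2 * n)) (k + 1) ∧
        BabyTKK.SeriesPowEqZero (BabyTKK.seriesMinus W (2 * n)) (k + 1) ∧
        BabyTKK.SeriesPowEqZero (BabyTKK.seriesPlus W (2 * n + 1)) (2 * k + 1) ∧
        BabyTKK.SeriesPowEqZero (BabyTKK.seriesMinus W (2 * n + 1)) (2 * k + 1) := by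
  open BabyTKK in
  have hp (n : ℤ) : seriesPlus W n = row W ePlus 1 n := by
    funext m
    rw [row, one_mul]
    rfl
  have hm (n : ℤ) : seriesMinus W n = row W eMinus 1 n := by
    funext m
    rw [row, one_mul]
    rfl
  have P := IsChevalleyPair.ePlus_eMinus
  have lp : IsLowered W ePlus := fun w n => (hres w n).1
  have lm : IsLowered W eMinus := fun w n => (hres w n).2.1
  simp only [hp, hm]
  constructor
  · intro hint
    have np : IsLocNilp W ePlus := fun m n h => (hint m n h).1
    have nm : IsLocNilp W eMinus := fun m n h => (hint m n h).2
    obtain ⟨k, hk⟩ := level_nat_of_isLocNilp P lp lm hlevel np nm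
    have hk1 : ((1 : ℤ) : ℂ) * ℓ = k := by simpa using hk
    have hev (n : ℤ) : Even (1 : ℤ) ∨ Even (2 * n) := Or.inr (even_two_mul n)
    exact ⟨k, hk, fun n =>
      ⟨row_seriesPowEqZero P lp lm hlevel np nm le_rfl (hev n) hk1,
        row_seriesPowEqZero P.symm lm lp hlevel nm np le_rfl (hev n) hk1,
        row_odd_seriesPowEqZero P lp lm hlevel np nm hk (odd_two_mul_add_one n),
        row_odd_seriesPowEqZero P.symm lm lp hlevel nm np hk (odd_two_mul_add_one n)⟩⟩
  · rintro ⟨k, -, hk⟩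
    have np := isLocNilp_of_row P.tr_left lp (fun n => (hk n).1) fun n => (hk n).2.2.1
    have nm := isLocNilp_of_row P.tr_right lm (fun n => (hk n).2.1) fun n => (hk n).2.2.2
    exact fun m n h => ⟨np m n h, nm m n h⟩
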